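/- Let $F=\mathbb{F}_q$ be a finite field, let $E=\mathbb{F}_{q^2}$ be its quadratic extension, and let $n\ge 1$. Let $N_n$ be the group of upper triangular unipotent matrices, and let $P_n$ be the mirabolic subgroup of $\mathrm{GL}_n$, i.e. the matrices with last row $(0,\dots,0,1)$. Let $e_1,\dots,e_n$ be the standard row vectors of $F^n$. Fix a non-trivial additive character $\psi:F\to\mathbb{C}^\times$ and a non-trivial additive character $\psi_{E/F}:E\to\mathbb{C}^\times$ that is trivial on $F$, and extend the latter to $N_n(E)$ by $\psi_{E/F}(u)=\psi_{E/F}(u_{1,2}+\dots+u_{n-1,n})$. For $\phi:F^n\to\mathbb{C}$ put $$\mathcal{F}_\psi(\phi)(y)=q^{-n/2}\sum_{x\in F^n}\phi(x)\,\psi(x\cdot{}^t y).$$ Let $\pi$ be an irreducible cuspidal complex representation of $\mathrm{GL}_n(E)$ on $V$. Its Whittaker model $\mathcal{W}(\pi,\psi_{E/F})$ is the space of functions on $\mathrm{GL}_n(E)$ spanned by the functions $W(g)=\ell(\pi(g)v)$ with $v\in V$ and $\ell:V\to\mathbb{C}$ linear such that $\ell(\pi(u)v')=\psi_{E/F}(u)\ell(v')$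 for all $u\in N_n(E)$ and $v'\in V$. Then $$\dim\mathrm{Hom}_{P_n(F)}(\pi|_{P_n(F)},\mathbf{1})\le 1,$$ and there is a unique complex number $\gamma(\pi,\mathrm{As},\psi)$ such that for all $W\in\mathcal{W}(\pi,\psi_{E/F})$ and all $\phi:F^n\to\mathbb{C}$ with $\phi(0)=0$, $$\gamma(\pi,\mathrm{As},\psi)\sum_{g\in N_n(F)\backslash \mathrm{GL}_n(F)}W(g)\,\phi(e_n g)=\sum_{g\in N_n(F)\backslash \mathrm{GL}_n(F)}W(g)\,\mathcal{F}_\psi(\phi)(e_1\,{}^t g^{-1}).$$ -/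

import Mathlib

open scoped Matrix MatrixGroups

noncomputable section

namespace FiniteAsai

/-- The index of the last coordinate of a (nonempty) row vector of length `n`. -/
def lastIdx (n : ℕ) [NeZero n] : Fin n := Fin.rev 0

/-- The first standard row vector `e₁ = (1, 0, …, 0)`. -/
def eFirst (n : ℕ) [NeZero n] (K : Type*) [Field K] : Fin n → K := Pi.single 0 1

/-- The last standard row vector `eₙ = (0, …, 0, 1)`. -/
def eLast (n : ℕ) [NeZero n] (K : Type*) [Field K] : Fin n → K := Pi.single (lastIdx n) 1

theorem unipotent_mul_apply {n : ℕ} {K : Type*} [Field K] {a b : Matrix (Fin n) (Fin n) K}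
    (ha : ∀ i j : Fin n, j ≤ i → a i j = (1 : Matrix (Fin n) (Fin n) K) i j)
    (i j : Fin n) : (a * b) i j = b i j + ∑ k ∈ Finset.Ioi i, a i k * b k j := by
  rw [Matrix.mul_apply, ← Finset.sum_subset (Finset.subset_univ (Finset.Ici i)),
    ← Finset.Ioi_insert, Finset.sum_insert (by simp), ha i i le_rfl]
  · simp
  · intro k _ hk
    have hk' : k < i := by simpa using hk
    rw [ha i k hk'.le, Matrix.one_apply_ne hk'.ne', zero_mul]

/-- The group `N_n(K)` of upper triangular unipotent matrices. -/
def unipotentSubgroup (n : ℕ) (K : Type*) [Field K] : Subgroup (GL (Fin n) K) where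
  carrier := {g | ∀ i j : Fin n, j ≤ i → g.val i j = (1 : Matrix (Fin n) (Fin n) K) i j}
  one_mem' := fun i j _ => rfl
  mul_mem' := by
    intro a b ha hb i j hij
    rw [Units.val_mul, unipotent_mul_apply ha i j, hb i j hij, Finset.sum_eq_zero, add_zero]
    intro k hk
    have hk' : i < k := by simpa using hk
    rw [hb k j (hij.trans hk'.le), Matrix.one_apply_ne (hij.trans_lt hk').ne', mul_zero]
  inv_mem' := by
    intro a ha i
    have main : ∀ m : ℕ, ∀ i : Fin n, n - i.val ≤ m → ∀ j : Fin n, j ≤ i →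
        (a⁻¹).val i j = (1 : Matrix (Fin n) (Fin n) K) i j := by
      intro m
      induction m with
      | zero => intro i hi; have := i.isLt; omega
      | succ m ih =>
        intro i hi j hij
        have h1 : (a.val * (a⁻¹).val) i j = (1 : Matrix (Fin n) (Fin n) K) i j := by
          rw [← Units.val_mul, mul_inv_cancel]; rfl
        rw [unipotent_mul_apply ha i j, Finset.sum_eq_zero, add_zero] at h1
        · exact h1
        · intro k hk
          have hk' : i < k := by simpa using hk
          have h2 : i.val < k.val := hk'
          rw [ih k (by omega) j (hij.trans hk'.le),
            Matrix.one_apply_ne (hij.trans_lt hk').ne', mul_zero]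
    exact main _ i le_rfl

/-- The mirabolic subgroup `P_n(K)`: the matrices in `GL_n(K)` whose last row is
`(0, …, 0, 1)`. -/
def mirabolic (n : ℕ) [NeZero n] (K : Type*) [Field K] : Subgroup (GL (Fin n) K) where
  carrier := {g | g.val (lastIdx n) = eLast n K}
  one_mem' := by
    ext j
    simp [eLast, Matrix.one_apply, Pi.single_apply, eq_comm]
  mul_mem' := by
    intro a b ha hb
    have ha' : a.val (lastIdx n) = eLast n K := ha
    have hb' : b.val (lastIdx n) = eLast n K := hb
    change (a * b).val (lastIdx n) = eLast n K
    rw [← hb']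
    ext j
    rw [Units.val_mul, Matrix.mul_apply, ha']
    simp [eLast, Pi.single_apply]
  inv_mem' := by
    intro a ha
    have ha' : a.val (lastIdx n) = eLast n K := ha
    have h1 : (a.val * (a⁻¹).val) (lastIdx n) = (1 : Matrix (Fin n) (Fin n) K) (lastIdx n) := by
      rw [← Units.val_mul, mul_inv_cancel]; rfl
    ext j
    have h2 := congrFun h1 j
    rw [Matrix.mul_apply, ha'] at h2
    simpa [eLast, Matrix.one_apply, Pi.single_apply, eq_comm] using h2

/-- The character `u ↦ ψ(u₁₂ + u₂₃ + ⋯ + u_{n-1,n})` of `N_n(K)` attached to an additive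
character `ψ` of `K` (written as a function of arbitrary matrices). -/
def whittakerChar {n : ℕ} {K : Type*} [Field K] (ψ : AddChar K ℂ)
    (u : Matrix (Fin n) (Fin n) K) : ℂ :=
  ψ (∑ i : Fin n, ∑ j : Fin n, if i.val + 1 = j.val then u i j else 0)

/-- A representation of `GL_n(K)` (`K` a finite field) is cuspidal if, for each `0 < k < n`, it
has no nonzero vector fixed by the unipotent radical `{(1_k, X; 0, 1_{n-k})}` of the standard
maximal parabolic subgroup of type `(k, n - k)`.  (The unipotent radical of any proper standard
parabolic subgroup contains one of these.) -/
def IsCuspidal {n : ℕ} {K : Type*} [Field K] {V : Type*} [AddCommGroup V] [Module ℂ V]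
    (π : Representation ℂ (GL (Fin n) K) V) : Prop :=
  ∀ k : ℕ, 0 < k → k < n → ∀ v : V,
    (∀ u : GL (Fin n) K,
      (∀ i j : Fin n, ¬ (i.val < k ∧ k ≤ j.val) →
        u.val i j = (1 : Matrix (Fin n) (Fin n) K) i j) → π u v = v) →
    v = 0

/-- `ℓ` is a `ψ`-Whittaker functional of `π`: `ℓ(π(u)v) = ψ(u) ℓ(v)` for `u ∈ N_n(K)`. -/
def IsWhittakerFunctional {n : ℕ} {K : Type*} [Field K] {V : Type*} [AddCommGroup V] [Module ℂ V]
    (π : Representation ℂ (GL (Fin n) K) V) (ψ : AddChar K ℂ) (ℓ : Module.Dual ℂ V) : Prop :=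
  ∀ u ∈ unipotentSubgroup n K, ∀ v : V, ℓ (π u v) = whittakerChar ψ u.val * ℓ v

/-- The Whittaker model `𝒲(π, ψ)`: the space of functions on `GL_n(K)` generated by the Whittaker
functions `g ↦ ℓ(π(g)v)`, for `ℓ` a Whittaker functional and `v` a vector.  See
`whittakerModel_eq_span_matrixCoeff` for the description by matrix coefficients. -/
def whittakerModel {n : ℕ} {K : Type*} [Field K] {V : Type*} [AddCommGroup V] [Module ℂ V]
    (π : Representation ℂ (GL (Fin n) K) V) (ψ : AddChar K ℂ) :
    Submodule ℂ (GL (Fin n) K → ℂ) :=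
  Submodule.span ℂ
    {W | ∃ ℓ : Module.Dual ℂ V, IsWhittakerFunctional π ψ ℓ ∧ ∃ v : V, ∀ g, W g = ℓ (π g v)}

/-- The Fourier transform on functions on `F^n`, normalised by `q^{-n/2}`, `q = #F`. -/
def finiteFourier {n : ℕ} {F : Type*} [Field F] [Fintype F] (ψ : AddChar F ℂ)
    (φ : (Fin n → F) → ℂ) (y : Fin n → F) : ℂ :=
  (((Fintype.card F : ℝ) ^ (-(n : ℝ) / 2) : ℝ) : ℂ) * ∑ x : Fin n → F, φ x * ψ (x ⬝ᵥ y)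

/-- The sum `∑_{g ∈ N \ G} f(g)` over right cosets `N g`, for a left `N`-invariant function `f`
(the value does not depend on the chosen representatives, see `cosetSum_eq`). -/
def cosetSum {G : Type*} [Group G] (N : Subgroup G) (f : G → ℂ) : ℂ :=
  ∑ᶠ c : Quotient (QuotientGroup.rightRel N), f c.out

/-- The inclusion `GL_n(F) → GL_n(E)` for a field extension `E/F`. -/
def glIncl (n : ℕ) (F E : Type*) [Field F] [Field E] [Algebra F E] :
    GL (Fin n) F →* GL (Fin n) E :=
  Matrix.GeneralLinearGroup.map (algebraMap F E)

/-- The space `Hom_{P_n(F)}(π|_{P_n(F)}, 1)` for a representation `π` of `GL_n(E)`. -/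
abbrev MirabolicHom {n : ℕ} [NeZero n] (F : Type*) {E : Type*} [Field F] [Field E] [Algebra F E]
    {V : Type*} [AddCommGroup V] [Module ℂ V] (π : Representation ℂ (GL (Fin n) E) V) : Type _ :=
  Representation.IntertwiningMap
    (π.comp ((glIncl n F E).comp (mirabolic n F).subtype))
    (Representation.trivial ℂ (mirabolic n F) ℂ)

/-! Well-definedness facts. -/

theorem cosetSum_eq {G : Type*} [Group G] [Fintype G] (N : Subgroup G) (f : G → ℂ)
    (hf : ∀ u ∈ N, ∀ g, f (u * g) = f g) :
    cosetSum N f = (Nat.card N : ℂ)⁻¹ * ∑ g : G, f g := by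
  classical
  have hout : ∀ g : G, f (Quotient.mk (QuotientGroup.rightRel N) g).out = f g := by
    intro g
    have h := Quotient.exact (Quotient.out_eq (Quotient.mk (QuotientGroup.rightRel N) g))
    have h' := QuotientGroup.rightRel_apply.mp h
    have := hf _ h' (Quotient.mk (QuotientGroup.rightRel N) g).out
    rw [inv_mul_cancel_right] at this
    exact this.symm
  have hN : (Nat.card N : ℂ) ≠ 0 := by exact_mod_cast Nat.card_pos.ne'
  rw [cosetSum, finsum_eq_sum_of_fintype, eq_inv_mul_iff_mul_eq₀ hN, Finset.mul_sum,
    ← Finset.sum_fiberwise Finset.univ (fun g : G => Quotient.mk (QuotientGroup.rightRel N) g)]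
  refine Finset.sum_congr rfl fun c _ => ?_
  have hconst : ∀ g ∈ Finset.univ.filter
      (fun g : G => Quotient.mk (QuotientGroup.rightRel N) g = c), f g = f c.out := by
    intro g hg
    rw [← (Finset.mem_filter.mp hg).2, hout]
  rw [Finset.sum_congr rfl hconst, Finset.sum_const, nsmul_eq_mul]
  congr 2
  rw [Nat.card_eq_fintype_card, ← Finset.card_univ]
  refine Finset.card_bij (fun u _ => u.val * c.out) ?_ ?_ ?_
  · intro u _
    refine Finset.mem_filter.mpr ⟨Finset.mem_univ _, ?_⟩
    conv_rhs => rw [← Quotient.out_eq c]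
    refine Quotient.sound (QuotientGroup.rightRel_apply.mpr ?_)
    have : c.out * (u.val * c.out)⁻¹ = (u⁻¹).val := by simp
    rw [this]; exact (u⁻¹).2
  · intro u _ w _ h
    exact Subtype.ext (mul_right_cancel h)
  · intro g hg
    have hg' := (Finset.mem_filter.mp hg).2
    have h1 : Quotient.mk (QuotientGroup.rightRel N) c.out = Quotient.mk _ g := by
      rw [hg']; exact Quotient.out_eq c
    have h2 := QuotientGroup.rightRel_apply.mp (Quotient.exact h1)
    exact ⟨⟨_, h2⟩, Finset.mem_univ _, by simp⟩

theorem whittaker_mul {n : ℕ} {K : Type*} [Field K] {V : Type*} [AddCommGroup V] [Module ℂ V]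
    (π : Representation ℂ (GL (Fin n) K) V) (ψ : AddChar K ℂ) {W : GL (Fin n) K → ℂ}
    (hW : W ∈ whittakerModel π ψ) {u : GL (Fin n) K} (hu : u ∈ unipotentSubgroup n K)
    (g : GL (Fin n) K) : W (u * g) = whittakerChar ψ u.val * W g := by
  induction hW using Submodule.span_induction with
  | mem W h =>
    obtain ⟨ℓ, hℓ, v, hW⟩ := h
    rw [hW, hW, map_mul, Module.End.mul_apply, hℓ u hu]
  | zero => simp
  | add x y _ _ hx hy => simp [hx, hy, mul_add]
  | smul a x _ hx => simp [hx]; ring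

theorem whittakerChar_glIncl {n : ℕ} {F E : Type*} [Field F] [Field E] [Algebra F E]
    (ψE : AddChar E ℂ) (hψEF : ∀ x : F, ψE (algebraMap F E x) = 1) (u : GL (Fin n) F) :
    whittakerChar ψE (glIncl n F E u).val = 1 := by
  rw [whittakerChar, ← hψEF (∑ i : Fin n, ∑ j : Fin n, if i.val + 1 = j.val then u.val i j else 0)]
  congr 1
  simp only [map_sum]
  refine Finset.sum_congr rfl fun i _ => Finset.sum_congr rfl fun j _ => ?_
  split_ifs <;> simp [glIncl]

theorem glIncl_mem_unipotent {n : ℕ} {F E : Type*} [Field F] [Field E] [Algebra F E]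
    {u : GL (Fin n) F} (hu : u ∈ unipotentSubgroup n F) :
    glIncl n F E u ∈ unipotentSubgroup n E := by
  intro i j hij
  have h := hu i j hij
  simp only [glIncl, Matrix.GeneralLinearGroup.map_apply, h, Matrix.one_apply]
  split_ifs <;> simp

theorem eLast_vecMul_unipotent {n : ℕ} [NeZero n] {F : Type*} [Field F]
    {u : GL (Fin n) F} (hu : u ∈ unipotentSubgroup n F) : eLast n F ᵥ* u.val = eLast n F := by
  ext j
  have hj : j ≤ lastIdx n := by
    rw [Fin.le_def, lastIdx, Fin.val_rev, Fin.val_zero]; have := j.isLt; omega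
  rw [eLast, Matrix.single_one_vecMul, Matrix.row_apply, hu _ _ hj]
  simp [Matrix.one_apply, Pi.single_apply, eq_comm]

theorem eFirst_vecMul_unipotent {n : ℕ} [NeZero n] {F : Type*} [Field F]
    {u : GL (Fin n) F} (hu : u ∈ unipotentSubgroup n F) : eFirst n F ᵥ* u.valᵀ = eFirst n F := by
  ext j
  have hj : (0 : Fin n) ≤ j := by
    rw [Fin.le_def, Fin.val_zero]; omega
  rw [eFirst, Matrix.single_one_vecMul, Matrix.row_apply, Matrix.transpose_apply, hu _ _ hj]
  simp [Matrix.one_apply, Pi.single_apply]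

/-- The summand of the Flicker sum is left `N_n(F)`-invariant. -/
theorem flicker_summand_invariant {n : ℕ} [NeZero n] {F E : Type*} [Field F] [Field E]
    [Algebra F E] (ψE : AddChar E ℂ) (hψEF : ∀ x : F, ψE (algebraMap F E x) = 1)
    {V : Type*} [AddCommGroup V] [Module ℂ V] (π : Representation ℂ (GL (Fin n) E) V)
    {W : GL (Fin n) E → ℂ} (hW : W ∈ whittakerModel π ψE) (φ : (Fin n → F) → ℂ)
    (u : GL (Fin n) F) (hu : u ∈ unipotentSubgroup n F) (g : GL (Fin n) F) :
    W (glIncl n F E (u * g)) * φ (eLast n F ᵥ* (u * g).val) =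
      W (glIncl n F E g) * φ (eLast n F ᵥ* g.val) := by
  rw [map_mul, whittaker_mul π ψE hW (glIncl_mem_unipotent hu), whittakerChar_glIncl ψE hψEF,
    one_mul, Units.val_mul, ← Matrix.vecMul_vecMul, eLast_vecMul_unipotent hu]

/-- The summand of the dual Flicker sum is left `N_n(F)`-invariant. -/
theorem dualFlicker_summand_invariant {n : ℕ} [NeZero n] {F E : Type*} [Field F] [Field E]
    [Algebra F E] (ψE : AddChar E ℂ) (hψEF : ∀ x : F, ψE (algebraMap F E x) = 1)
    {V : Type*} [AddCommGroup V] [Module ℂ V] (π : Representation ℂ (GL (Fin n) E) V)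
    {W : GL (Fin n) E → ℂ} (hW : W ∈ whittakerModel π ψE) (φ : (Fin n → F) → ℂ)
    (u : GL (Fin n) F) (hu : u ∈ unipotentSubgroup n F) (g : GL (Fin n) F) :
    W (glIncl n F E (u * g)) * φ (eFirst n F ᵥ* ((u * g)⁻¹).valᵀ) =
      W (glIncl n F E g) * φ (eFirst n F ᵥ* (g⁻¹).valᵀ) := by
  rw [map_mul, whittaker_mul π ψE hW (glIncl_mem_unipotent hu), whittakerChar_glIncl ψE hψEF,
    one_mul, _root_.mul_inv_rev, Units.val_mul, Matrix.transpose_mul, ← Matrix.vecMul_vecMul,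
    eFirst_vecMul_unipotent (inv_mem hu)]

/-- For an invariant inner product, the Whittaker model is generated by the matrix coefficients
`g ↦ (π(g)v, v₀)` with `v₀` a Whittaker vector, `π(u)v₀ = ψ(u)v₀` for `u ∈ N_n(K)`. -/
theorem whittakerModel_eq_span_matrixCoeff {n : ℕ} {K : Type*} [Field K] [Finite K] {V : Type*}
    [NormedAddCommGroup V] [InnerProductSpace ℂ V] [FiniteDimensional ℂ V]
    (π : Representation ℂ (GL (Fin n) K) V) (ψ : AddChar K ℂ)
    (hinv : ∀ g v w, inner ℂ (π g v) (π g w) = inner ℂ v w) :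
    whittakerModel π ψ = Submodule.span ℂ
      {W | ∃ v₀ : V, (∀ u ∈ unipotentSubgroup n K, π u v₀ = whittakerChar ψ u.val • v₀) ∧
        ∃ v : V, ∀ g, W g = inner ℂ v₀ (π g v)} := by
  have hnorm : ∀ u : Matrix (Fin n) (Fin n) K,
      (starRingEnd ℂ) (whittakerChar ψ u) * whittakerChar ψ u = 1 := by
    intro u
    rw [whittakerChar, mul_comm, Complex.mul_conj, Complex.normSq_eq_norm_sq, AddChar.norm_apply]
    simp
  have key : ∀ v₀ : V, (∀ u ∈ unipotentSubgroup n K, π u v₀ = whittakerChar ψ u.val • v₀) ↔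
      IsWhittakerFunctional π ψ (innerₛₗ ℂ v₀) := by
    intro v₀
    constructor
    · intro h u hu v
      have h1 := hinv u v₀ v
      rw [h u hu, inner_smul_left] at h1
      simp only [innerₛₗ_apply_apply]
      rw [← h1, ← mul_assoc, mul_comm (whittakerChar ψ u.val), hnorm, one_mul]
    · intro h u hu
      refine ext_inner_right ℂ fun w => ?_
      have h1 := h u hu (π u⁻¹ w)
      simp only [innerₛₗ_apply_apply, Representation.self_inv_apply] at h1
      have h2 := hinv u v₀ (π u⁻¹ w)
      rw [Representation.self_inv_apply] at h2
      rw [inner_smul_left, h2, h1, ← mul_assoc, hnorm, one_mul]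
  unfold whittakerModel
  congr 1
  ext W
  constructor
  · rintro ⟨ℓ, hℓ, v, hW⟩
    obtain ⟨v₀, hv₀⟩ := (InnerProductSpace.toDual ℂ V).surjective (LinearMap.toContinuousLinearMap ℓ)
    have hl : ∀ w, ℓ w = inner ℂ v₀ w := by
      intro w
      rw [← InnerProductSpace.toDual_apply_apply, hv₀]; rfl
    have hl' : ℓ = innerₛₗ ℂ v₀ := by
      ext w; simp [hl]
    exact ⟨v₀, (key v₀).mpr (hl' ▸ hℓ), v, fun g => by rw [hW, hl]⟩
  · rintro ⟨v₀, hv₀, v, hW⟩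
    exact ⟨innerₛₗ ℂ v₀, (key v₀).mp hv₀, v, fun g => by rw [hW]; rfl⟩

end FiniteAsai

end

open FiniteAsai

/-!
Write `PW k` for the vectors on which the column subgroups `U_j` of `N_n(E)`, `j ≥ k`, act by the
character prescribed by `ψ_{E/F}`.  Everything rests on a descent from `PW (k + 1)` to `PW k`
(`mem_of_isWhittakerVector_mem`): decompose a vector of `PW (k + 1)` under the abelian group `U_k`.
The trivial character does not occur, because a vector on which it acts would be fixed by the
unipotent radical of type `(k, n - k)`, against cuspidality.  A nontrivial character
`x ↦ ψ_{E/F}(y ⬝ x)` with `y` rational over a subfield `K` is conjugate under the mirabolic group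
`P_n(K)` to the prescribed one.

* With `K = E` this shows that nonzero Whittaker vectors exist.
* With `K = F` it shows that a `P_n(F)`-invariant functional is determined by its values on
  Whittaker vectors (`eq_zero_of_mirabolic_invariant`): it kills every `U_k`-eigenvector whose
  character is nontrivial on `U_k(F)`, and the orthogonal complement of `F` in `E` for `ψ_{E/F}` is
  `F`.

Whittaker vectors in an irreducible representation are unique up to scalars
(`exists_eq_smul_of_isWhittakerVector`).  This is Gelfand's trick: for the idempotent `e` of
`(N_n, ψ)`, reflection in the antidiagonal fixes every element of `e ℂ[GL_n] e`, which is therefore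
commutative.  By elimination it is enough to consider `e m e` with `m` monomial, and if `e m e ≠ 0`,
then comparing the characters of root subgroups shows that `m` is block antidiagonal with scalar
blocks.  It follows that `Hom_{P_n(F)}(π, 1)` has dimension at most one, and that the Whittaker model
consists of the functions `g ↦ ℓ₀(π(g)v)` for a single functional `ℓ₀`.

Both sides of the functional equation are equivariant bilinear forms in `v` and `φ`.  For `φ` the
delta function at `eₙ` they are `P_n(F)`-invariant functionals of `v`, hence determined by their
values at the Whittaker vector `v₀`; all other delta functions off the origin are translates of this
one.  The constant `γ` is the quotient of the two values at `v₀`.  The denominator is nonzero,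
because on the mirabolic subgroup `g ↦ ℓ₀(π(g)v₀)` is supported on the unipotent group
(`mem_unipotent_of_apply_ne_zero`).
-/

open scoped Matrix MatrixGroups

noncomputable section

namespace FiniteAsai

/-! ### Column subgroups of the unipotent group -/

section Matrices

variable {n : ℕ} {K : Type*} [Field K]

/-- The vector `x` with its entries at the indices `≥ k` replaced by `0`. -/
def trunc (k : ℕ) (x : Fin n → K) : Fin n → K := fun i => if i.val < k then x i else 0

/-- The entry of `x` at the index `j - 1`, and `0` if there is no such index. -/
def prevCoord (j : ℕ) (x : Fin n → K) : K := ∑ i : Fin n, if i.val + 1 = j then x i else 0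

theorem trunc_of_lt {k : ℕ} {x : Fin n → K} {i : Fin n} (h : i.val < k) : trunc k x i = x i :=
  if_pos h

theorem trunc_of_le {k : ℕ} {x : Fin n → K} {i : Fin n} (h : k ≤ i.val) : trunc k x i = 0 :=
  if_neg h.not_gt

theorem trunc_eq_self {k : ℕ} {x : Fin n → K} (h : ∀ i : Fin n, k ≤ i.val → x i = 0) :
    trunc k x = x := by
  ext i
  by_cases hi : i.val < k
  · exact trunc_of_lt hi
  · rw [trunc_of_le (not_lt.mp hi), h i (not_lt.mp hi)]

theorem trunc_trunc (k : ℕ) (x : Fin n → K) : trunc k (trunc k x) = trunc k x :=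
  trunc_eq_self fun _ hi => trunc_of_le hi

theorem trunc_add (k : ℕ) (x y : Fin n → K) : trunc k (x + y) = trunc k x + trunc k y := by
  ext i; simp only [trunc, Pi.add_apply]; split_ifs <;> simp

theorem trunc_dotProduct (k : ℕ) (x y : Fin n → K) : trunc k x ⬝ᵥ y = x ⬝ᵥ trunc k y := by
  refine Finset.sum_congr rfl fun i _ => ?_
  simp only [trunc]; split_ifs <;> simp

theorem prevCoord_eq {j : ℕ} {i : Fin n} (h : i.val + 1 = j) (x : Fin n → K) :
    prevCoord j x = x i := by
  rw [prevCoord, Finset.sum_eq_single i, if_pos h]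
  · intro b _ hb
    rw [if_neg]
    intro h'
    exact hb (Fin.ext (by omega))
  · simp

theorem prevCoord_zero_index (x : Fin n → K) : prevCoord 0 x = 0 :=
  Finset.sum_eq_zero fun _ _ => if_neg (by omega)

theorem prevCoord_trunc (j : ℕ) (x : Fin n → K) : prevCoord j (trunc j x) = prevCoord j x := by
  refine Finset.sum_congr rfl fun i _ => ?_
  split_ifs with h
  · exact trunc_of_lt (by omega)
  · rfl

theorem prevCoord_congr {j : ℕ} {x y : Fin n → K} (h : ∀ i : Fin n, i.val + 1 = j → x i = y i) :
    prevCoord j x = prevCoord j y := by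
  refine Finset.sum_congr rfl fun i _ => ?_
  split_ifs with h'
  · exact h i h'
  · rfl

theorem det_one_add_vecMulVec (a b : Fin n → K) :
    (1 + Matrix.vecMulVec a b).det = 1 + b ⬝ᵥ a := by
  rw [Matrix.vecMulVec_eq Unit, Matrix.det_one_add_replicateCol_mul_replicateRow]

theorem exists_val_eq_one_add_vecMulVec (a b : Fin n → K) (h : 1 + b ⬝ᵥ a ≠ 0) :
    ∃ g : GL (Fin n) K, g.val = 1 + Matrix.vecMulVec a b :=
  ⟨Matrix.GeneralLinearGroup.mkOfDetNeZero _ (by rwa [det_one_add_vecMulVec]), rfl⟩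

/-- The unipotent matrix whose column `k` has the entries of `x` above the diagonal, and which
agrees with the identity matrix in the other columns; the entries `x i` with `k ≤ i` are
disregarded. -/
def colUnip (k : Fin n) (x : Fin n → K) : GL (Fin n) K :=
  Matrix.GeneralLinearGroup.mkOfDetNeZero (1 + Matrix.vecMulVec (trunc k x) (Pi.single k 1)) (by
    rw [det_one_add_vecMulVec, single_one_dotProduct, trunc_of_le le_rfl, add_zero]
    exact one_ne_zero)

theorem colUnip_val (k : Fin n) (x : Fin n → K) :
    (colUnip k x).val = 1 + Matrix.vecMulVec (trunc k x) (Pi.single k 1) := rfl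

theorem colUnip_apply (k : Fin n) (x : Fin n → K) (i j : Fin n) :
    (colUnip k x).val i j = (1 : Matrix (Fin n) (Fin n) K) i j +
      if i < k ∧ j = k then x i else 0 := by
  rw [colUnip_val, Matrix.add_apply, Matrix.vecMulVec_apply, Pi.single_apply, trunc]
  by_cases h : i < k <;> by_cases h' : j = k <;> simp [h, h']

theorem colUnip_eq_one {k : Fin n} {x : Fin n → K} (h : trunc k x = 0) : colUnip k x = 1 := by
  refine Units.ext ?_
  rw [colUnip_val, h, Matrix.zero_vecMulVec, add_zero]; rfl

theorem colUnip_add (k : Fin n) (x y : Fin n → K) :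
    colUnip k (x + y) = colUnip k x * colUnip k y := by
  refine Units.ext ?_
  rw [Units.val_mul]
  simp only [colUnip_val]
  rw [trunc_add, Matrix.add_vecMulVec, add_mul, mul_add, mul_add,
    Matrix.vecMulVec_mul_vecMulVec, single_one_dotProduct, trunc_of_le le_rfl]
  simp only [one_mul, mul_one, zero_smul, Matrix.vecMulVec_zero, add_zero]
  abel

theorem colUnip_row_of_le {k : Fin n} (x : Fin n → K) {i : Fin n} (h : k ≤ i) :
    (colUnip k x).val i = Pi.single i 1 := by
  ext j
  rw [colUnip_apply, if_neg (fun h' => absurd h'.1 h.not_gt), add_zero, Matrix.one_apply,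
    Pi.single_apply]
  simp [eq_comm]

theorem one_add_vecMulVec_mem_unipotent {k : ℕ} {a b : Fin n → K}
    (ha : ∀ i : Fin n, k ≤ i.val → a i = 0) (hb : ∀ i : Fin n, i.val < k → b i = 0)
    {g : GL (Fin n) K} (hg : g.val = 1 + Matrix.vecMulVec a b) : g ∈ unipotentSubgroup n K := by
  intro i j hij
  rw [hg, Matrix.add_apply, Matrix.vecMulVec_apply]
  by_cases hi : i.val < k
  · rw [hb j (lt_of_le_of_lt hij hi), mul_zero, add_zero]
  · rw [ha i (not_lt.mp hi), zero_mul, add_zero]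

theorem whittakerChar_one_add_vecMulVec (ψ : AddChar K ℂ) {k : Fin n} {a b : Fin n → K}
    (ha : ∀ i, k ≤ i → a i = 0) (hb : ∀ i, i < k → b i = 0) (hb1 : b k = 1) :
    whittakerChar ψ (1 + Matrix.vecMulVec a b) = ψ (prevCoord k a) := by
  rw [whittakerChar, prevCoord]
  congr 1
  refine Finset.sum_congr rfl fun i _ => ?_
  rw [Finset.sum_eq_single k]
  · split_ifs with h
    · rw [Matrix.add_apply, Matrix.vecMulVec_apply, hb1, Matrix.one_apply_ne, zero_add, mul_one]
      rintro rfl; omega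
    · rfl
  · intro j _ hj
    split_ifs with h
    · rw [Matrix.add_apply, Matrix.vecMulVec_apply, Matrix.one_apply_ne, zero_add]
      · rcases lt_or_ge j k with h' | h'
        · rw [hb j h', mul_zero]
        · rw [ha i, zero_mul]
          have : k < j := lt_of_le_of_ne h' (Ne.symm hj)
          rw [Fin.le_def]; rw [Fin.lt_def] at this; omega
      · rintro rfl; omega
    · rfl
  · simp

theorem colUnip_mem_unipotent (k : Fin n) (x : Fin n → K) :
    colUnip k x ∈ unipotentSubgroup n K :=
  one_add_vecMulVec_mem_unipotent (k := k) (fun _ hi => trunc_of_le hi)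
    (fun i hi => Pi.single_eq_of_ne (by rintro rfl; exact lt_irrefl _ hi) _) rfl

theorem whittakerChar_colUnip (ψ : AddChar K ℂ) (k : Fin n) (x : Fin n → K) :
    whittakerChar ψ (colUnip k x).val = ψ (prevCoord k x) := by
  rw [colUnip_val, whittakerChar_one_add_vecMulVec ψ (fun _ hi => trunc_of_le hi)
    (fun i hi => Pi.single_eq_of_ne hi.ne _) (Pi.single_eq_same _ _), prevCoord_trunc]

/-- The whole unipotent group is generated by the column subgroups: `u` is the product of the
matrices `colUnip j (col j u)`, the largest `j` on the left. -/
theorem unipotent_mem_of_colUnip_mem (M : Submonoid (GL (Fin n) K)) {u : GL (Fin n) K}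
    (hu : u ∈ unipotentSubgroup n K) (h : ∀ j, colUnip j (fun i => u.val i j) ∈ M) : u ∈ M := by
  -- the matrix that agrees with `u` in the first `m` columns
  have key : ∀ m : ℕ, m ≤ n → ∃ w ∈ M, ∀ i j : Fin n, w.val i j =
      if j.val < m then u.val i j else (1 : Matrix (Fin n) (Fin n) K) i j := by
    intro m
    induction m with
    | zero => exact fun _ => ⟨1, one_mem _, fun i j => by simp⟩
    | succ m ih =>
      intro hm
      obtain ⟨w, hw, hwu⟩ := ih (by omega)
      obtain ⟨k, rfl⟩ : ∃ k : Fin n, k.val = m := ⟨⟨m, hm⟩, rfl⟩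
      refine ⟨colUnip k (fun i => u.val i k) * w, mul_mem (h k) hw, fun i j => ?_⟩
      have hrow : Pi.single k 1 ᵥ* w.val = Pi.single k 1 := by
        ext l
        rw [Matrix.single_one_vecMul, Matrix.row_apply, hwu]
        split_ifs with hl
        · rw [hu k l (Fin.le_def.mpr hl.le), Matrix.one_apply, Pi.single_apply]; simp [eq_comm]
        · rw [Matrix.one_apply, Pi.single_apply]; simp [eq_comm]
      rw [Units.val_mul, colUnip_val, add_mul, one_mul, Matrix.vecMulVec_mul, hrow,
        Matrix.add_apply, Matrix.vecMulVec_apply, hwu]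
      rcases lt_trichotomy j k with hj | hj | hj
      · have hj' : j.val < k.val := hj
        rw [if_pos hj', if_pos (Nat.lt_succ_of_lt hj'), Pi.single_eq_of_ne hj.ne, mul_zero, add_zero]
      · rw [hj, if_neg (lt_irrefl _), if_pos (Nat.lt_succ_self _), Pi.single_eq_same, mul_one]
        rcases lt_or_ge i k with hi | hi
        · rw [Matrix.one_apply_ne hi.ne, trunc_of_lt hi, zero_add]
        · rw [trunc_of_le hi, hu i k hi, add_zero]
      · have hj' : k.val < j.val := hj
        rw [if_neg (by omega), if_neg (by omega), Pi.single_eq_of_ne hj.ne', mul_zero, add_zero]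
  obtain ⟨w, hw, hwu⟩ := key n le_rfl
  have : u = w := Units.ext (by ext i j; rw [hwu, if_pos j.isLt])
  rwa [this]

theorem whittakerChar_one (ψ : AddChar K ℂ) :
    whittakerChar ψ (1 : Matrix (Fin n) (Fin n) K) = 1 := by
  rw [whittakerChar, Finset.sum_eq_zero, AddChar.map_zero_eq_one]
  intro i _
  refine Finset.sum_eq_zero fun j _ => ?_
  split_ifs with h
  · exact Matrix.one_apply_ne (by rintro rfl; omega)
  · rfl

theorem whittakerChar_mul (ψ : AddChar K ℂ) {a b : GL (Fin n) K}
    (ha : a ∈ unipotentSubgroup n K) (hb : b ∈ unipotentSubgroup n K) :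
    whittakerChar ψ (a * b).val = whittakerChar ψ a.val * whittakerChar ψ b.val := by
  simp only [whittakerChar]
  rw [← AddChar.map_add_eq_mul, ← Finset.sum_add_distrib]
  congr 1
  refine Finset.sum_congr rfl fun i _ => ?_
  rw [← Finset.sum_add_distrib]
  refine Finset.sum_congr rfl fun j _ => ?_
  split_ifs with h
  · have hij : i < j := by rw [Fin.lt_def]; omega
    rw [Units.val_mul, unipotent_mul_apply ha, Finset.sum_eq_single j, hb j j le_rfl,
      Matrix.one_apply_eq, mul_one, add_comm]
    · intro l hl hlj
      have hl' : i < l := by simpa using hl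
      have : j < l := lt_of_le_of_ne (by rw [Fin.le_def]; rw [Fin.lt_def] at hl'; omega) hlj.symm
      rw [hb l j this.le, Matrix.one_apply_ne this.ne', mul_zero]
    · intro hj
      exact absurd (by simpa using hij) hj
  · simp

theorem whittakerChar_ne_zero (ψ : AddChar K ℂ) (u : Matrix (Fin n) (Fin n) K) :
    whittakerChar ψ u ≠ 0 := by
  rw [whittakerChar]
  exact (ψ.val_isUnit _).ne_zero

/-- A matrix whose rows with index `≥ k` are those of the identity normalises the column subgroup
with index `k`. -/
theorem mul_colUnip {g : GL (Fin n) K} {k : Fin n} (hg : ∀ i, k ≤ i → g.val i = Pi.single i 1)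
    (z : Fin n → K) : g * colUnip k z = colUnip k (g.val *ᵥ trunc k z) * g := by
  refine Units.ext ?_
  have h1 : trunc k (g.val *ᵥ trunc k z) = g.val *ᵥ trunc k z := by
    refine trunc_eq_self fun i hi => ?_
    rw [Matrix.mulVec, hg i hi, single_one_dotProduct, trunc_of_le hi]
  have h2 : Pi.single k 1 ᵥ* g.val = Pi.single k 1 := by
    rw [Matrix.single_one_vecMul]; exact hg k le_rfl
  rw [Units.val_mul, Units.val_mul, colUnip_val, colUnip_val, h1, mul_add, add_mul, mul_one,
    one_mul, Matrix.mul_vecMulVec, Matrix.vecMulVec_mul, h2]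

theorem inv_row_of_row {g : GL (Fin n) K} {i : Fin n} (h : g.val i = Pi.single i 1) :
    (g⁻¹).val i = Pi.single i 1 := by
  have h1 : (g.val * (g⁻¹).val) i = (1 : Matrix (Fin n) (Fin n) K) i := by
    rw [← Units.val_mul, mul_inv_cancel]; rfl
  ext l
  have h2 := congrFun h1 l
  rw [Matrix.mul_apply, h] at h2
  simpa [Pi.single_apply, Matrix.one_apply, eq_comm] using h2

/-- A nonzero vector `y` supported on the indices `< k` is row `k - 1` of an invertible matrix that
agrees with the identity in the rows `≥ k`. -/
theorem exists_row_eq {k : ℕ} {l : Fin n} (hl : l.val + 1 = k) {y : Fin n → K}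
    (hy : ∀ i : Fin n, k ≤ i.val → y i = 0) (hy0 : y ≠ 0) :
    ∃ g : GL (Fin n) K, (∀ i : Fin n, k ≤ i.val → g.val i = Pi.single i 1) ∧
      Pi.single l 1 ᵥ* g.val = y := by
  -- `1 + a ⊗ (y - e_l)` is such a matrix as soon as `a l = 1` and its determinant `y ⬝ a` is nonzero
  suffices ∃ a : Fin n → K, a l = 1 ∧ (∀ i : Fin n, k ≤ i.val → a i = 0) ∧ y ⬝ᵥ a ≠ 0 by
    obtain ⟨a, hal, ha, hya⟩ := this
    obtain ⟨g, hg⟩ := exists_val_eq_one_add_vecMulVec a (y - Pi.single l 1)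
      (by rwa [sub_dotProduct, single_one_dotProduct, hal, add_sub_cancel])
    refine ⟨g, fun i hi => ?_, ?_⟩
    · ext j
      rw [hg, Matrix.add_apply, Matrix.vecMulVec_apply, ha i hi, zero_mul, add_zero,
        Matrix.one_apply, Pi.single_apply]
      simp [eq_comm]
    · rw [hg, Matrix.vecMul_add, Matrix.vecMul_one, Matrix.vecMul_vecMulVec,
        single_one_dotProduct, hal, one_smul, add_sub_cancel]
  by_cases hyl : y l = 0
  · obtain ⟨i, hi⟩ := Function.ne_iff.mp hy0
    have hil : l ≠ i := by rintro rfl; exact hi hyl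
    have hik : i.val < k := by
      by_contra h
      exact hi (hy i (not_lt.mp h))
    refine ⟨Pi.single l 1 + Pi.single i 1, ?_, fun j hj => ?_, ?_⟩
    · simp [Pi.single_eq_of_ne hil]
    · rw [Pi.add_apply, Pi.single_eq_of_ne (by rintro rfl; omega),
        Pi.single_eq_of_ne (by rintro rfl; omega), add_zero]
    · rw [dotProduct_add, dotProduct_single_one, dotProduct_single_one, hyl, zero_add]
      exact hi
  · refine ⟨Pi.single l 1, Pi.single_eq_same _ _, fun j hj => ?_, ?_⟩
    · exact Pi.single_eq_of_ne (by rintro rfl; omega) _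
    · rwa [dotProduct_single_one]

theorem colUnip_mem_mirabolic [NeZero n] (k : Fin n) (x : Fin n → K) :
    colUnip k x ∈ mirabolic n K :=
  colUnip_row_of_le x (by
    rw [Fin.le_def, lastIdx, Fin.val_rev, Fin.val_zero]; have := k.isLt; omega)

end Matrices

/-! ### Descent to Whittaker vectors -/

section Descent

variable {n : ℕ} {E : Type*} [Field E] {V : Type*} [AddCommGroup V] [Module ℂ V]

/-- `v` is a `ψ`-Whittaker vector of `π`: `π(u)v = ψ(u)v` for `u ∈ N_n`. -/
def IsWhittakerVector (π : Representation ℂ (GL (Fin n) E) V) (ψ : AddChar E ℂ) (v : V) : Prop :=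
  ∀ u ∈ unipotentSubgroup n E, π u v = whittakerChar ψ u.val • v

/-- The Whittaker condition for the column subgroups with index `≥ k` only. -/
def IsPartialWhittakerVector (π : Representation ℂ (GL (Fin n) E) V) (ψ : AddChar E ℂ) (k : ℕ)
    (v : V) : Prop :=
  ∀ j : Fin n, k ≤ j.val → ∀ x, π (colUnip j x) v = ψ (prevCoord j x) • v

/-- The Whittaker vectors form a subspace. -/
def whittakerVectors (π : Representation ℂ (GL (Fin n) E) V) (ψ : AddChar E ℂ) :
    Submodule ℂ V where
  carrier := {v | IsWhittakerVector π ψ v}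
  zero_mem' := fun u _ => by rw [map_zero, smul_zero]
  add_mem' := fun ha hb u hu => by rw [map_add, ha u hu, hb u hu, smul_add]
  smul_mem' := fun c v hv u hu => by rw [map_smul, hv u hu, smul_comm]

variable {π : Representation ℂ (GL (Fin n) E) V} {ψ : AddChar E ℂ}

theorem IsPartialWhittakerVector.isWhittakerVector {v : V}
    (hv : IsPartialWhittakerVector π ψ 0 v) : IsWhittakerVector π ψ v := by
  intro u hu
  let M : Submonoid (GL (Fin n) E) :=
    { carrier := {g | g ∈ unipotentSubgroup n E ∧ π g v = whittakerChar ψ g.val • v}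
      one_mem' := ⟨one_mem _, by rw [map_one, Units.val_one, whittakerChar_one, one_smul]; rfl⟩
      mul_mem' := by
        rintro a b ⟨ha, ha'⟩ ⟨hb, hb'⟩
        refine ⟨mul_mem ha hb, ?_⟩
        rw [map_mul, Module.End.mul_apply, hb', map_smul, ha', smul_smul,
          whittakerChar_mul ψ ha hb, mul_comm] }
  refine (unipotent_mem_of_colUnip_mem M hu fun j => ?_).2
  exact ⟨colUnip_mem_unipotent _ _, by rw [whittakerChar_colUnip, hv j (Nat.zero_le _)]⟩

theorem IsPartialWhittakerVector.map_of_rows {k : ℕ} {v : V}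
    (hv : IsPartialWhittakerVector π ψ (k + 1) v) {g : GL (Fin n) E}
    (hg : ∀ i : Fin n, k ≤ i.val → g.val i = Pi.single i 1) :
    IsPartialWhittakerVector π ψ (k + 1) (π g v) := by
  -- `g` normalises the column subgroups in question and preserves their characters
  intro j hj x
  obtain ⟨g', rfl⟩ : ∃ g' : GL (Fin n) E, g = g'⁻¹ := ⟨g⁻¹, by simp⟩
  have hg' : ∀ i : Fin n, k ≤ i.val → g'.val i = Pi.single i 1 := by
    intro i hi
    simpa using inv_row_of_row (hg i hi)
  have h := mul_colUnip (g := g') (k := j)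
    (fun i hi => hg' i (by rw [Fin.le_def] at hi; omega)) x
  have h3 : colUnip j x * g'⁻¹ = g'⁻¹ * colUnip j (g'.val *ᵥ trunc j x) := by
    rw [eq_inv_mul_iff_mul_eq, ← mul_assoc, h, mul_inv_cancel_right]
  rw [← Module.End.mul_apply, ← map_mul, h3, map_mul, Module.End.mul_apply, hv j hj, map_smul]
  congr 2
  rw [← prevCoord_trunc _ x]
  refine prevCoord_congr fun i hi => ?_
  rw [Matrix.mulVec, hg' i (by omega), single_one_dotProduct]

theorem eq_zero_of_isPartialWhittakerVector_of_fixed (hcusp : IsCuspidal π) {k : Fin n}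
    (hk : 0 < k.val) {v : V} (hv : IsPartialWhittakerVector π ψ (k + 1) v)
    (hfix : ∀ x, π (colUnip k x) v = v) : v = 0 := by
  -- the unipotent radical of type `(k, n - k)` does not meet the superdiagonal beyond column `k`
  refine hcusp k hk k.isLt v fun u hu => ?_
  let M : Submonoid (GL (Fin n) E) :=
    { carrier := {g | π g v = v}
      one_mem' := by simp
      mul_mem' := by
        intro a b ha hb
        have ha' : π a v = v := ha
        have hb' : π b v = v := hb
        change π (a * b) v = v
        rw [map_mul, Module.End.mul_apply, hb', ha'] }
  have huN : u ∈ unipotentSubgroup n E := fun i j hij => hu i j (by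
    rw [Fin.le_def] at hij; omega)
  refine unipotent_mem_of_colUnip_mem M huN fun j => ?_
  change π _ v = v
  rcases lt_trichotomy j.val k.val with hj | hj | hj
  · rw [colUnip_eq_one, map_one, Module.End.one_apply]
    ext i
    by_cases hi : i.val < j.val
    · rw [trunc_of_lt hi, hu i j (by omega), Matrix.one_apply_ne (by rintro rfl; omega)]; rfl
    · exact trunc_of_le (not_lt.mp hi)
  · rw [Fin.ext hj, hfix]
  · rw [hv j hj]
    have : prevCoord j (fun i => u.val i j) = 0 := by
      refine Finset.sum_eq_zero fun i _ => ?_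
      split_ifs with h
      · exact (hu i j (by omega)).trans (Matrix.one_apply_ne (by rintro rfl; omega))
      · rfl
    rw [this, AddChar.map_zero_eq_one, one_smul]

theorem sum_addChar_dotProduct_eq_zero [Fintype E] (hψ : ψ ≠ 1) {b : Fin n → E} (hb : b ≠ 0) :
    ∑ y : Fin n → E, ψ (y ⬝ᵥ b) = 0 := by
  obtain ⟨i, hi⟩ := Function.ne_iff.mp hb
  obtain ⟨a, ha⟩ := AddChar.ne_one_iff.mp hψ
  let χ : AddChar (Fin n → E) ℂ :=
    { toFun := fun y => ψ (y ⬝ᵥ b)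
      map_zero_eq_one' := by rw [zero_dotProduct, AddChar.map_zero_eq_one]
      map_add_eq_mul' := fun x y => by rw [add_dotProduct, AddChar.map_add_eq_mul] }
  have hχ : χ ≠ 1 := by
    refine AddChar.ne_one_iff.mpr ⟨Pi.single i (a / b i), ?_⟩
    change ψ (Pi.single i (a / b i) ⬝ᵥ b) ≠ 1
    rwa [single_dotProduct, div_mul_cancel₀ _ hi]
  exact AddChar.sum_eq_zero_of_ne_one hχ

/-- The (unnormalised) projection of `v` to the eigenspace of the column subgroup with index `k`
for the character `x ↦ ψ(y ⬝ x)`, the sum being over the entries above the diagonal. -/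
def columnProj [Fintype E] (π : Representation ℂ (GL (Fin n) E) V) (ψ : AddChar E ℂ) (k : Fin n)
    (y : Fin n → E) (v : V) : V :=
  ∑ x : Fin n → E, ψ (-(trunc k y ⬝ᵥ x)) • π (colUnip k x) v

theorem map_colUnip_columnProj [Fintype E] (k : Fin n) (y z : Fin n → E) (v : V) :
    π (colUnip k z) (columnProj π ψ k y v) =
      ψ (trunc k y ⬝ᵥ z) • columnProj π ψ k y v := by
  rw [columnProj, map_sum, Finset.smul_sum]
  refine Fintype.sum_equiv (Equiv.addLeft z) _ _ fun x => ?_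
  rw [Equiv.coe_addLeft, map_smul, ← Module.End.mul_apply, ← map_mul, ← colUnip_add, smul_smul,
    ← AddChar.map_add_eq_mul, dotProduct_add]
  congr 2
  ring

theorem exists_sum_columnProj_eq_smul [Fintype E] (hψ : ψ ≠ 1) (k : Fin n) :
    ∃ c : ℂ, c ≠ 0 ∧ ∀ v, ∑ y, columnProj π ψ k y v = c • v := by
  classical
  refine ⟨∑ x : Fin n → E, if trunc k x = 0 then (Fintype.card (Fin n → E) : ℂ) else 0,
    ?_, fun v => ?_⟩
  · rw [← Finset.sum_filter, Finset.sum_const, nsmul_eq_mul]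
    refine mul_ne_zero ?_ (by exact_mod_cast Fintype.card_ne_zero)
    rw [Nat.cast_ne_zero, Finset.card_ne_zero]
    exact ⟨0, Finset.mem_filter.mpr ⟨Finset.mem_univ _, trunc_eq_self fun _ _ => rfl⟩⟩
  · simp only [columnProj]
    rw [Finset.sum_comm, Finset.sum_smul]
    refine Finset.sum_congr rfl fun x _ => ?_
    rw [← Finset.sum_smul]
    split_ifs with hx
    · rw [colUnip_eq_one hx, map_one, Module.End.one_apply]
      congr 1
      rw [Finset.sum_congr rfl (g := fun _ => 1), Finset.sum_const, nsmul_one, Finset.card_univ]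
      intro y _
      rw [trunc_dotProduct, hx, dotProduct_zero, neg_zero, AddChar.map_zero_eq_one]
    · rw [Finset.sum_congr rfl (g := fun y => ψ (y ⬝ᵥ (-trunc k x))),
        sum_addChar_dotProduct_eq_zero hψ (neg_ne_zero.mpr hx), zero_smul, zero_smul]
      intro y _
      rw [trunc_dotProduct, dotProduct_neg]

theorem IsPartialWhittakerVector.columnProj [Fintype E] {k : Fin n} {v : V}
    (hv : IsPartialWhittakerVector π ψ (k + 1) v) (y : Fin n → E) :
    IsPartialWhittakerVector π ψ (k + 1) (columnProj π ψ k y v) := by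
  intro j hj x
  rw [FiniteAsai.columnProj, map_sum, Finset.smul_sum]
  refine Finset.sum_congr rfl fun z _ => ?_
  rw [map_smul, (hv.map_of_rows fun i hi => colUnip_row_of_le z hi) j hj, smul_comm]

theorem glIncl_row_of_row {K : Type*} [Field K] [Algebra K E] {g : GL (Fin n) K} {i : Fin n}
    (h : g.val i = Pi.single i 1) : (glIncl n K E g).val i = Pi.single i 1 := by
  ext j
  rw [glIncl, Matrix.GeneralLinearGroup.map_apply, h, Pi.single_apply, Pi.single_apply]
  split_ifs <;> simp

theorem glIncl_colUnip {K : Type*} [Field K] [Algebra K E] (k : Fin n) (x : Fin n → K) :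
    glIncl n K E (colUnip k x) = colUnip k (fun i => algebraMap K E (x i)) := by
  refine Units.ext ?_
  ext i j
  rw [colUnip_apply, glIncl, Matrix.GeneralLinearGroup.map_apply, colUnip_apply, map_add,
    Matrix.one_apply, Matrix.one_apply]
  split_ifs <;> simp

/-- Let `Z` be a subspace stable under the mirabolic group of a field `K` contained in `E`, such
that the eigenvectors of the column subgroups outside `Z` have `K`-rational characters.  If `Z`
contains all Whittaker vectors, then it is everything.  Column by column from the right: cuspidality
excludes the trivial character, and all other `K`-rational characters of a column are conjugate
under the mirabolic group to the one prescribed by `ψ`. -/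
theorem mem_of_isWhittakerVector_mem [Fintype E] [NeZero n] {K : Type*} [Field K] [Algebra K E]
    (hψ : ψ ≠ 1) (hcusp : IsCuspidal π) (Z : Submodule ℂ V)
    (hZ : ∀ g ∈ mirabolic n K, ∀ v ∈ Z, π (glIncl n K E g) v ∈ Z)
    (hrat : ∀ (k : Fin n) (y : Fin n → E) (v : V),
      (∀ x, π (colUnip k x) v = ψ (trunc k y ⬝ᵥ x) • v) →
        v ∈ Z ∨ ∃ y₀ : Fin n → K, trunc k y = fun i => algebraMap K E (y₀ i))
    (hW : ∀ v, IsWhittakerVector π ψ v → v ∈ Z) (v : V) : v ∈ Z := by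
  suffices h : ∀ k : ℕ, k ≤ n → ∀ v, IsPartialWhittakerVector π ψ k v → v ∈ Z from
    h n le_rfl v fun j hj => absurd j.isLt (by omega)
  intro m
  induction m with
  | zero => exact fun _ v hv => hW v hv.isWhittakerVector
  | succ m ih =>
    intro hm v hv
    obtain ⟨k, rfl⟩ : ∃ k : Fin n, k.val = m := ⟨⟨m, hm⟩, rfl⟩
    rcases Nat.eq_zero_or_pos k.val with hk | hk
    · -- the column subgroup with index `0` is trivial
      refine ih (by omega) v fun j hj x => ?_
      rcases Nat.lt_or_ge k.val j.val with h | h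
      · exact hv j h x
      · have hj0 : j.val = 0 := by omega
        rw [colUnip_eq_one, map_one, hj0, prevCoord_zero_index, AddChar.map_zero_eq_one, one_smul,
          Module.End.one_apply]
        ext i
        exact trunc_of_le (by omega)
    obtain ⟨c, hc, hsum⟩ := exists_sum_columnProj_eq_smul (π := π) hψ k
    suffices h : ∀ y, columnProj π ψ k y v ∈ Z by
      have h1 : c • v ∈ Z := hsum v ▸ Z.sum_mem fun y _ => h y
      simpa [smul_smul, inv_mul_cancel₀ hc] using Z.smul_mem c⁻¹ h1
    intro y
    have hf := hv.columnProj y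
    have heig := fun z => map_colUnip_columnProj (π := π) (ψ := ψ) k y z v
    set f := columnProj π ψ k y v with hfdef
    by_cases hy : trunc k y = 0
    · rw [eq_zero_of_isPartialWhittakerVector_of_fixed hcusp hk hf]
      · exact Z.zero_mem
      · intro x
        rw [heig, hy, zero_dotProduct, AddChar.map_zero_eq_one, one_smul]
    rcases hrat k y f heig with h | ⟨y₀, hy₀⟩
    · exact h
    obtain ⟨l, hl⟩ : ∃ l : Fin n, l.val + 1 = k.val := ⟨⟨k.val - 1, by omega⟩, by simp; omega⟩
    have hinj := (algebraMap K E).injective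
    obtain ⟨g, hg, hgy⟩ := exists_row_eq hl (y := y₀)
      (fun i hi => hinj (by rw [← congrFun hy₀ i, trunc_of_le hi, map_zero]))
      (by
        rintro rfl
        exact hy (hy₀.trans (by ext i; simp)))
    have hgP : g ∈ mirabolic n K := by
      refine hg (lastIdx n) ?_
      rw [lastIdx, Fin.val_rev, Fin.val_zero]; omega
    set g' := glIncl n K E g with hg'
    have hrow : ∀ i : Fin n, k.val ≤ i.val → g'.val i = Pi.single i 1 :=
      fun i hi => glIncl_row_of_row (hg i hi)
    have hrowl : g'.val l = trunc k y := by
      ext j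
      rw [hy₀, ← hgy, Matrix.single_one_vecMul, hg', glIncl, Matrix.GeneralLinearGroup.map_apply]
      rfl
    -- `π(g')` moves the character of the column `k` to the one prescribed by `ψ`
    have hmem : π g' f ∈ Z := by
      refine ih (by omega) _ fun j hj x => ?_
      rcases Nat.lt_or_ge k.val j.val with h | h
      · exact hf.map_of_rows hrow j h x
      · obtain rfl : j = k := Fin.ext (by omega)
        obtain ⟨z, hz⟩ : ∃ z, g'.val *ᵥ trunc j z = trunc j x := by
          refine ⟨(g'⁻¹).val *ᵥ trunc j x, ?_⟩
          rw [trunc_eq_self, Matrix.mulVec_mulVec, ← Units.val_mul, mul_inv_cancel, Units.val_one,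
            Matrix.one_mulVec]
          intro i hi
          rw [Matrix.mulVec, inv_row_of_row (hrow i hi), single_one_dotProduct, trunc_of_le hi]
        have h1 : colUnip j x * g' = g' * colUnip j z := by
          rw [mul_colUnip (fun i hi => hrow i hi), hz]
          congr 1
          exact Units.ext (by rw [colUnip_val, colUnip_val, trunc_trunc])
        rw [← Module.End.mul_apply, ← map_mul, h1, map_mul, Module.End.mul_apply, heig, map_smul]
        congr 2
        rw [prevCoord_eq hl, ← trunc_of_lt (k := j.val) (x := x) (i := l) (by omega), ← hz,
          Matrix.mulVec, hrowl, ← trunc_dotProduct, trunc_trunc]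
    have := hZ g⁻¹ (inv_mem hgP) _ hmem
    rwa [map_inv, ← hg', Representation.inv_self_apply] at this

end Descent

/-! ### Existence of Whittaker vectors and functionals invariant under the mirabolic subgroup -/

section Consequences

variable {n : ℕ} [NeZero n] {E : Type*} [Field E] [Fintype E] {V : Type*} [AddCommGroup V]
  [Module ℂ V] {π : Representation ℂ (GL (Fin n) E) V} {ψ : AddChar E ℂ}

theorem exists_isWhittakerVector_ne_zero [Nontrivial V] (hψ : ψ ≠ 1) (hcusp : IsCuspidal π) :
    ∃ v, IsWhittakerVector π ψ v ∧ v ≠ 0 := by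
  by_contra! h
  obtain ⟨v, hv⟩ := exists_ne (0 : V)
  refine hv ((Submodule.mem_bot ℂ).mp ?_)
  refine mem_of_isWhittakerVector_mem (K := E) hψ hcusp ⊥ ?_ (fun k y _ _ => Or.inr ⟨trunc k y, rfl⟩)
    (fun v hv => (Submodule.mem_bot ℂ).mpr (h v hv)) v
  intro g _ v hv
  rw [(Submodule.mem_bot ℂ).mp hv, map_zero]
  exact Submodule.zero_mem _

/-- For a quadratic extension `E/F`, the orthogonal complement of `F` for the pairing
`(z, a) ↦ ψ(za)` is `F` itself, if `ψ` is nontrivial on `E` and trivial on `F`. -/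
theorem mem_range_algebraMap_of_addChar {F : Type*} [Field F] [Algebra F E]
    (hEF : Module.finrank F E = 2) (hψ : ψ ≠ 1) (hψF : ∀ a : F, ψ (algebraMap F E a) = 1) {z : E}
    (hz : ∀ a : F, ψ (z * algebraMap F E a) = 1) : ∃ a : F, z = algebraMap F E a := by
  have : Module.Finite F E := Module.finite_of_finrank_pos (by omega)
  let S : Submodule F E :=
    { carrier := {w | ∀ a : F, ψ (w * algebraMap F E a) = 1}
      zero_mem' := fun a => by rw [zero_mul, AddChar.map_zero_eq_one]
      add_mem' := fun {w w'} hw hw' a => by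
        rw [add_mul, AddChar.map_add_eq_mul, hw a, hw' a, one_mul]
      smul_mem' := fun c w hw a => by
        have := hw (c * a)
        rwa [(algebraMap F E).map_mul, ← mul_assoc, mul_comm w, ← Algebra.smul_def] at this }
  have hS : S ≠ ⊤ := by
    intro h
    refine hψ (DFunLike.ext _ _ fun w => ?_)
    have hw : w ∈ S := h ▸ Submodule.mem_top
    simpa using hw 1
  have hle : F ∙ (1 : E) ≤ S := by
    rw [Submodule.span_singleton_le_iff_mem]
    exact fun a => by rw [one_mul, hψF]
  have heq : F ∙ (1 : E) = S := by
    refine Submodule.eq_of_le_of_finrank_le hle ?_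
    have := Submodule.finrank_lt hS
    rw [finrank_span_singleton one_ne_zero]
    omega
  have hzS : z ∈ F ∙ (1 : E) := heq ▸ hz
  obtain ⟨a, rfl⟩ := Submodule.mem_span_singleton.mp hzS
  exact ⟨a, by rw [Algebra.algebraMap_eq_smul_one]⟩

/-- A functional invariant under the mirabolic subgroup of the smaller field is determined by its
values on Whittaker vectors. -/
theorem eq_zero_of_mirabolic_invariant {F : Type*} [Field F] [Algebra F E]
    (hEF : Module.finrank F E = 2) (hψ : ψ ≠ 1) (hψF : ∀ a : F, ψ (algebraMap F E a) = 1)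
    (hcusp : IsCuspidal π) (ℓ : V →ₗ[ℂ] ℂ)
    (hℓ : ∀ g ∈ mirabolic n F, ∀ v, ℓ (π (glIncl n F E g) v) = ℓ v)
    (hW : ∀ v, IsWhittakerVector π ψ v → ℓ v = 0) : ℓ = 0 := by
  classical
  refine LinearMap.ext fun v => ?_
  rw [LinearMap.zero_apply, ← LinearMap.mem_ker]
  refine mem_of_isWhittakerVector_mem (K := F) hψ hcusp (LinearMap.ker ℓ) ?_ ?_
    (fun v hv => LinearMap.mem_ker.mpr (hW v hv)) v
  · intro g hg v hv
    rw [LinearMap.mem_ker, hℓ g hg, LinearMap.mem_ker.mp hv]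
  · intro k y v hv
    rw [LinearMap.mem_ker]
    refine or_iff_not_imp_left.mpr fun hne => ?_
    have h1 : ∀ x : Fin n → F, ψ (trunc k y ⬝ᵥ fun i => algebraMap F E (x i)) = 1 := by
      intro x
      have h := hℓ _ (colUnip_mem_mirabolic k x) v
      rw [glIncl_colUnip, hv, map_smul, smul_eq_mul] at h
      exact mul_right_cancel₀ hne (h.trans (one_mul _).symm)
    have h2 : ∀ i, ∃ a : F, trunc k y i = algebraMap F E a := by
      intro i
      refine mem_range_algebraMap_of_addChar hEF hψ hψF fun a => ?_
      rw [← h1 (Pi.single i a)]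
      congr 1
      rw [show (fun j => algebraMap F E ((Pi.single i a : Fin n → F) j)) =
        Pi.single i (algebraMap F E a) from ?_, dotProduct_single]
      ext j
      rw [Pi.single_apply, Pi.single_apply]
      split_ifs <;> simp
    choose y₀ hy₀ using h2
    exact ⟨y₀, funext hy₀⟩

end Consequences

/-! ### Reduction to monomial matrices -/

section Bruhat

variable {n : ℕ} {K : Type*} [Field K]

/-- Gaussian elimination: every double coset of the upper triangular unipotent group contains a
monomial matrix. -/
theorem exists_unipotent_mul_mul_eq_monomial (g : GL (Fin n) K) :
    ∃ u₁ ∈ unipotentSubgroup n K, ∃ u₂ ∈ unipotentSubgroup n K, ∃ (σ : Equiv.Perm (Fin n))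
      (t : Fin n → K), (∀ j, t j ≠ 0) ∧
        ∀ i j, (u₁ * g * u₂).val i j = if i = σ j then t j else 0 := by
  -- after `m` steps each of the first `m` columns has one nonzero entry, alone in its row
  have key : ∀ m : ℕ, m ≤ n → ∃ u₁ ∈ unipotentSubgroup n K, ∃ u₂ ∈ unipotentSubgroup n K,
      ∃ r : Fin n → Fin n, ∀ j : Fin n, j.val < m →
        (∀ i, i ≠ r j → (u₁ * g * u₂).val i j = 0) ∧
        (∀ l, l ≠ j → (u₁ * g * u₂).val (r j) l = 0) := by
    intro m
    induction m with
    | zero => exact fun _ => ⟨1, one_mem _, 1, one_mem _, id, fun j hj => absurd hj (by omega)⟩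
    | succ m ih =>
      intro hm
      obtain ⟨u₁, hu₁, u₂, hu₂, r, hr⟩ := ih (by omega)
      obtain ⟨k, rfl⟩ : ∃ k : Fin n, k.val = m := ⟨⟨m, hm⟩, rfl⟩
      obtain ⟨h, hh⟩ : ∃ h : GL (Fin n) K, h = u₁ * g * u₂ := ⟨_, rfl⟩
      rw [← hh] at hr
      -- the lowest nonzero entry of the column `k` is the pivot
      obtain ⟨p, hp, hpmax⟩ : ∃ p, h.val p k ≠ 0 ∧ ∀ i, p < i → h.val i k = 0 := by
        classical
        have hne : (Finset.univ.filter fun i => h.val i k ≠ 0).Nonempty := by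
          by_contra hemp
          rw [Finset.not_nonempty_iff_eq_empty, Finset.filter_eq_empty_iff] at hemp
          have h1 : ((h⁻¹).val * h.val) k k = (1 : Matrix (Fin n) (Fin n) K) k k := by
            rw [← Units.val_mul, inv_mul_cancel]; rfl
          rw [Matrix.mul_apply, Finset.sum_eq_zero, Matrix.one_apply_eq] at h1
          · exact zero_ne_one h1
          · intro i _
            rw [not_not.mp (hemp (Finset.mem_univ i)), mul_zero]
        refine ⟨Finset.max' _ hne, (Finset.mem_filter.mp (Finset.max'_mem _ hne)).2, ?_⟩
        intro i hi
        by_contra hc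
        exact absurd (Finset.le_max' _ i (Finset.mem_filter.mpr ⟨Finset.mem_univ _, hc⟩))
          hi.not_ge
      have hrp : ∀ j : Fin n, j.val < k.val → r j ≠ p := by
        intro j hj he
        exact hp (he ▸ (hr j hj).2 k (by rintro rfl; exact lt_irrefl _ hj))
      have hpj : ∀ j : Fin n, j.val < k.val → h.val p j = 0 :=
        fun j hj => (hr j hj).1 p (hrp j hj).symm
      -- clear the column above the pivot, and then the row to the right of it
      obtain ⟨a, ha⟩ : ∃ a : Fin n → K, a = fun i => - h.val i k / h.val p k := ⟨_, rfl⟩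
      obtain ⟨b, hb⟩ : ∃ b : Fin n → K, b = fun j => if k < j then - h.val p j / h.val p k else 0 :=
        ⟨_, rfl⟩
      have hbk : b k = 0 := by rw [hb]; exact if_neg (lt_irrefl _)
      obtain ⟨w, hw⟩ := exists_val_eq_one_add_vecMulVec (Pi.single k 1) b (by
        rw [dotProduct_single_one, hbk, add_zero]; exact one_ne_zero)
      have hwN : w ∈ unipotentSubgroup n K := by
        refine one_add_vecMulVec_mem_unipotent (k := k.val + 1) (fun i hi => ?_) (fun i hi => ?_) hw
        · exact Pi.single_eq_of_ne (by rintro rfl; omega) _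
        · rw [hb]; exact if_neg (by rw [Fin.lt_def]; omega)
      have hentry : ∀ i j, (colUnip p a * h * w).val i j =
          (h.val i j + (if i < p then a i else 0) * h.val p j) +
            (h.val i k + (if i < p then a i else 0) * h.val p k) * b j := by
        intro i j
        have e1 : (colUnip p a).val * h.val = h.val + Matrix.vecMulVec (trunc p a) (h.val p) := by
          rw [colUnip_val, add_mul, one_mul, Matrix.vecMulVec_mul, Matrix.single_one_vecMul]; rfl
        rw [Units.val_mul, Units.val_mul, e1, hw, mul_add, mul_one, Matrix.mul_vecMulVec,
          Matrix.mulVec_single_one, Matrix.add_apply, Matrix.vecMulVec_apply, Matrix.col_apply,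
          Matrix.add_apply, Matrix.add_apply, Matrix.vecMulVec_apply, Matrix.vecMulVec_apply]
        rfl
      have hcol : ∀ i, i ≠ p → h.val i k + (if i < p then a i else 0) * h.val p k = 0 := by
        intro i hi
        rcases lt_or_gt_of_ne hi with hlt | hlt
        · rw [if_pos hlt, ha]; field_simp; ring
        · rw [if_neg hlt.not_gt, hpmax i hlt]; ring
      refine ⟨colUnip p a * u₁, mul_mem (colUnip_mem_unipotent _ _) hu₁, u₂ * w, mul_mem hu₂ hwN,
        Function.update r k p, fun j hj => ?_⟩
      rw [show colUnip p a * u₁ * g * (u₂ * w) = colUnip p a * h * w by rw [hh]; group]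
      rcases Nat.lt_succ_iff_lt_or_eq.mp hj with hjk | hjk
      · have hjk' : j ≠ k := by rintro rfl; exact lt_irrefl _ hjk
        have hbj : b j = 0 := by rw [hb]; exact if_neg (by rw [Fin.lt_def]; omega)
        rw [Function.update_of_ne hjk']
        refine ⟨fun i hi => ?_, fun l hl => ?_⟩
        · rw [hentry, hbj, hpj j hjk, (hr j hjk).1 i hi]; ring
        · rw [hentry, hcol _ (hrp j hjk), (hr j hjk).2 l hl]
          have : a (r j) = 0 := by
            rw [ha]; simp only; rw [(hr j hjk).2 k hjk'.symm]; ring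
          rw [this]; simp
      · obtain rfl : j = k := Fin.ext hjk
        rw [Function.update_self]
        refine ⟨fun i hi => ?_, fun l hl => ?_⟩
        · rw [hentry, hbk, hcol i hi]; ring
        · rw [hentry, if_neg (lt_irrefl _)]
          rcases lt_or_gt_of_ne hl with hlt | hlt
          · rw [hpj l hlt, hb]; simp only; rw [if_neg hlt.not_gt]; ring
          · rw [hb]; simp only; rw [if_pos hlt]; field_simp; ring
  obtain ⟨u₁, hu₁, u₂, hu₂, r, hr⟩ := key n le_rfl
  set m := u₁ * g * u₂ with hm
  have hr0 : ∀ j, m.val (r j) j ≠ 0 := by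
    intro j h0
    have h1 : ((m⁻¹).val * m.val) j j = (1 : Matrix (Fin n) (Fin n) K) j j := by
      rw [← Units.val_mul, inv_mul_cancel]; rfl
    rw [Matrix.mul_apply, Finset.sum_eq_zero, Matrix.one_apply_eq] at h1
    · exact zero_ne_one h1
    · intro i _
      by_cases hi : i = r j
      · rw [hi, h0, mul_zero]
      · rw [(hr j j.isLt).1 i hi, mul_zero]
  have hinj : Function.Injective r := by
    intro j l hjl
    by_contra hne
    exact hr0 j (hjl ▸ (hr l l.isLt).2 j hne)
  refine ⟨u₁, hu₁, u₂, hu₂, Equiv.ofBijective r (Finite.injective_iff_bijective.mp hinj),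
    fun j => m.val (r j) j, hr0, fun i j => ?_⟩
  rw [Equiv.ofBijective_apply]
  split_ifs with h
  · rw [h]
  · exact (hr j j.isLt).1 i h

/-- A permutation `ρ` such that every inverted pair `i < j`, `ρ i > ρ j`, consists of neighbours if
and only if its image does, reverses each block of a partition of `Fin n` into intervals.
In particular `ρ` is an involution, and a function that takes the same value on `i` and `i + 1`
whenever these are inverted neighbours is invariant under `ρ`. -/
theorem involutive_of_inversions {A : Type*} (ρ : Equiv.Perm (Fin n)) (t : Fin n → A)
    (h : ∀ i j : Fin n, i < j → ρ j < ρ i →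
      ((i.val + 1 = j.val ↔ (ρ j).val + 1 = (ρ i).val) ∧ (i.val + 1 = j.val → t i = t j))) :
    ∀ i, ρ (ρ i) = i ∧ t (ρ i) = t i := by
  -- the indices `< a` form a union of blocks
  suffices key : ∀ d a : ℕ, n - a ≤ d → (∀ i : Fin n, i.val < a →
      (ρ i).val < a ∧ ρ (ρ i) = i ∧ t (ρ i) = t i) → ∀ i, ρ (ρ i) = i ∧ t (ρ i) = t i from
    key n 0 (by omega) (fun i hi => absurd hi (by omega))
  intro d
  induction d with
  | zero => exact fun a ha hi i => (hi i (by have := i.isLt; omega)).2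
  | succ d ih =>
    intro a ha hlt
    by_cases han : n ≤ a
    · exact fun i => (hlt i (by have := i.isLt; omega)).2
    obtain ⟨s, rfl⟩ : ∃ s : Fin n, s.val = a := ⟨⟨a, by omega⟩, rfl⟩
    have hge : ∀ i : Fin n, s.val ≤ i.val → s.val ≤ (ρ i).val := by
      intro i hi
      by_contra hc
      have h1 := hlt (ρ i) (by omega)
      have h2 := h1.1
      rw [ρ.injective h1.2.1] at h2
      omega
    -- the block that starts at `s` ends at `ρ s`
    have hblock : ∀ e : ℕ, ∀ i : Fin n, i.val = s.val + e → i.val ≤ (ρ s).val →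
        (ρ i).val + e = (ρ s).val ∧ t i = t s := by
      intro e
      induction e using Nat.strong_induction_on with
      | _ e ihe =>
        intro i hi hile
        rcases Nat.eq_zero_or_pos e with rfl | he
        · obtain rfl : i = s := Fin.ext (by omega)
          exact ⟨rfl, rfl⟩
        obtain ⟨p, hp⟩ : ∃ p : Fin n, p.val + 1 = i.val := ⟨⟨i.val - 1, by omega⟩, by simp; omega⟩
        obtain ⟨hρp, htp⟩ := ihe (e - 1) (by omega) p (by omega) (by omega)
        obtain ⟨q, hq⟩ : ∃ q : Fin n, (ρ q).val + 1 = (ρ p).val := by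
          refine ⟨ρ.symm ⟨(ρ p).val - 1, by have := (ρ p).isLt; omega⟩, ?_⟩
          rw [Equiv.apply_symm_apply]; simp; omega
        have hqs : s.val ≤ q.val := by
          by_contra hc
          have := (hlt q (by omega)).1
          omega
        have hpq : p < q := by
          by_contra hc
          have hc' : q.val ≤ p.val := not_lt.mp hc
          have := (ihe (q.val - s.val) (by omega) q (by omega) (by omega)).1
          omega
        have hinv := h p q hpq (by rw [Fin.lt_def]; omega)
        have hqp := hinv.1.mpr hq
        obtain rfl : q = i := Fin.ext (by omega)
        exact ⟨by omega, (hinv.2 hqp).symm.trans htp⟩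
    refine ih ((ρ s).val + 1) (by have := hge s le_rfl; omega) fun i hi => ?_
    by_cases his : i.val < s.val
    · obtain ⟨h1, h2⟩ := hlt i his
      have := hge s le_rfl
      exact ⟨by omega, h2⟩
    · obtain ⟨h1, h2⟩ := hblock (i.val - s.val) i (by omega) (by omega)
      have h3 := hge i (by omega)
      obtain ⟨h4, h5⟩ := hblock ((ρ i).val - s.val) (ρ i) (by omega) (by omega)
      exact ⟨by omega, Fin.ext (by omega), h5.trans h2.symm⟩

end Bruhat

/-! ### Uniqueness of Whittaker vectors -/

section Flip

variable {n : ℕ} {K : Type*} [Field K]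

/-- The anti-involution `g ↦ w ᵗg w` of `GL_n`, with `w` the antidiagonal permutation matrix:
reflection of a matrix in its antidiagonal. -/
def antitranspose (g : GL (Fin n) K) : GL (Fin n) K where
  val := (g.val.submatrix Fin.revPerm Fin.revPerm)ᵀ
  inv := ((g⁻¹).val.submatrix Fin.revPerm Fin.revPerm)ᵀ
  val_inv := by
    rw [← Matrix.transpose_mul, Matrix.submatrix_mul_equiv, ← Units.val_mul, inv_mul_cancel,
      Units.val_one, Matrix.submatrix_one_equiv, Matrix.transpose_one]
  inv_val := by
    rw [← Matrix.transpose_mul, Matrix.submatrix_mul_equiv, ← Units.val_mul, mul_inv_cancel,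
      Units.val_one, Matrix.submatrix_one_equiv, Matrix.transpose_one]

theorem antitranspose_apply (g : GL (Fin n) K) (i j : Fin n) :
    (antitranspose g).val i j = g.val j.rev i.rev := rfl

theorem antitranspose_one : antitranspose (1 : GL (Fin n) K) = 1 := by
  refine Units.ext ?_
  ext i j
  rw [antitranspose_apply, Units.val_one, Matrix.one_apply, Matrix.one_apply]
  simp [eq_comm]

theorem antitranspose_mul (g h : GL (Fin n) K) :
    antitranspose (g * h) = antitranspose h * antitranspose g := by
  refine Units.ext ?_
  change ((g * h).val.submatrix Fin.revPerm Fin.revPerm)ᵀ =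
    (h.val.submatrix Fin.revPerm Fin.revPerm)ᵀ * (g.val.submatrix Fin.revPerm Fin.revPerm)ᵀ
  rw [← Matrix.transpose_mul, Matrix.submatrix_mul_equiv, Units.val_mul]

theorem antitranspose_antitranspose (g : GL (Fin n) K) : antitranspose (antitranspose g) = g := by
  refine Units.ext ?_
  ext i j
  rw [antitranspose_apply, antitranspose_apply, Fin.rev_rev, Fin.rev_rev]

theorem antitranspose_mem_unipotent {u : GL (Fin n) K} (hu : u ∈ unipotentSubgroup n K) :
    antitranspose u ∈ unipotentSubgroup n K := by
  intro i j hij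
  rw [antitranspose_apply, hu _ _ (Fin.rev_le_rev.mpr hij), Matrix.one_apply, Matrix.one_apply]
  simp [eq_comm]

theorem whittakerChar_antitranspose (ψ : AddChar K ℂ) (u : GL (Fin n) K) :
    whittakerChar ψ (antitranspose u).val = whittakerChar ψ u.val := by
  rw [whittakerChar, whittakerChar, Finset.sum_comm]
  congr 1
  refine Fintype.sum_equiv Fin.revPerm _ _ fun j => Fintype.sum_equiv Fin.revPerm _ _ fun i => ?_
  rw [antitranspose_apply, Fin.revPerm_apply, Fin.revPerm_apply, Fin.val_rev, Fin.val_rev]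
  have hi := i.isLt
  have hj := j.isLt
  by_cases h : i.val + 1 = j.val
  · rw [if_pos h, if_pos (by omega)]
  · rw [if_neg h, if_neg (by omega)]

theorem prevCoord_single (i : Fin n) (j : ℕ) (c : K) :
    prevCoord j (Pi.single i c) = if i.val + 1 = j then c else 0 := by
  split_ifs with h
  · rw [prevCoord_eq h, Pi.single_eq_same]
  · refine Finset.sum_eq_zero fun l _ => ?_
    split_ifs with hl
    · exact Pi.single_eq_of_ne (by rintro rfl; exact h hl) _
    · rfl

theorem trunc_single {i j : Fin n} (hij : i < j) (c : K) :
    trunc j (Pi.single i c) = Pi.single i c :=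
  trunc_eq_self fun l hl => Pi.single_eq_of_ne (by rintro rfl; rw [Fin.lt_def] at hij; omega) _

theorem eq_of_forall_addChar_mul_eq {ψ : AddChar K ℂ} (hψ : ψ ≠ 1) {a b : K}
    (h : ∀ x, ψ (x * a) = ψ (x * b)) : a = b := by
  by_contra hab
  refine hψ (DFunLike.ext _ _ fun x => ?_)
  have h1 := h (x / (a - b))
  have h2 : x = x / (a - b) * a - x / (a - b) * b := by
    rw [← mul_sub, div_mul_cancel₀ _ (sub_ne_zero.mpr hab)]
  rw [h2, AddChar.map_sub_eq_div, h1, div_self (ψ.val_isUnit _).ne_zero]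
  rfl

/-- The anti-automorphism of the group algebra induced by `antitranspose`. -/
def antitransposeAlgHom :
    MonoidAlgebra ℂ (GL (Fin n) K) →ₐ[ℂ] (MonoidAlgebra ℂ (GL (Fin n) K))ᵐᵒᵖ :=
  MonoidAlgebra.lift ℂ _ _
    { toFun := fun g => MulOpposite.op (MonoidAlgebra.of ℂ _ (antitranspose g))
      map_one' := by rw [antitranspose_one, map_one, MulOpposite.op_one]
      map_mul' := fun g h => by rw [antitranspose_mul, map_mul, MulOpposite.op_mul] }

theorem antitransposeAlgHom_of (g : GL (Fin n) K) :
    antitransposeAlgHom (MonoidAlgebra.of ℂ _ g) =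
      MulOpposite.op (MonoidAlgebra.of ℂ _ (antitranspose g)) := by
  rw [antitransposeAlgHom, MonoidAlgebra.lift_of]; rfl

end Flip

section Irreducible

variable {V : Type*} [AddCommGroup V] [Module ℂ V] {G : Type*} [Group G] {ρ : Representation ℂ G V}

theorem exists_asAlgebraHom_eq
    (hirr : ρ.IsIrreducible) {v : V} (hv : v ≠ 0) (w : V) :
    ∃ x : MonoidAlgebra ℂ G, ρ.asAlgebraHom x v = w := by
  let S : Subrepresentation ρ :=
    { toSubmodule := LinearMap.range ((LinearMap.applyₗ v).comp ρ.asAlgebraHom.toLinearMap)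
      apply_mem_toSubmodule := by
        rintro g _ ⟨x, rfl⟩
        refine ⟨MonoidAlgebra.of ℂ _ g * x, ?_⟩
        simp }
  have hvS : v ∈ S := ⟨1, by simp⟩
  rcases eq_bot_or_eq_top S with h | h
  · rw [h] at hvS
    exact absurd hvS hv
  · have hw : w ∈ S := by rw [h]; trivial
    obtain ⟨x, hx⟩ := hw
    exact ⟨x, hx⟩

theorem finiteDimensional_of_isIrreducible [Finite G] (hirr : ρ.IsIrreducible) :
    FiniteDimensional ℂ V := by
  by_cases h : ∃ v : V, v ≠ 0
  · obtain ⟨v, hv⟩ := h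
    have : Module.Finite ℂ (MonoidAlgebra ℂ G) := inferInstance
    exact Module.Finite.of_surjective ((LinearMap.applyₗ v).comp ρ.asAlgebraHom.toLinearMap)
      (exists_asAlgebraHom_eq hirr hv)
  · push Not at h
    have : Subsingleton V := ⟨fun a b => by rw [h a, h b]⟩
    infer_instance

end Irreducible

section GelfandGraev

variable {n : ℕ} {K : Type*} [Field K] [Fintype (unipotentSubgroup n K)]

/-- The element `∑ ψ(u)⁻¹ u` of the group algebra, the sum being over the unipotent group: a
multiple of the idempotent that projects to the Whittaker vectors. -/
def whittakerElt (ψ : AddChar K ℂ) : MonoidAlgebra ℂ (GL (Fin n) K) :=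
  ∑ u : unipotentSubgroup n K, (whittakerChar ψ u.val.val)⁻¹ • MonoidAlgebra.of ℂ _ u.val

variable {ψ : AddChar K ℂ}

theorem whittakerElt_mul_of {u : GL (Fin n) K} (hu : u ∈ unipotentSubgroup n K) :
    whittakerElt ψ * MonoidAlgebra.of ℂ _ u = whittakerChar ψ u.val • whittakerElt ψ := by
  rw [whittakerElt, Finset.sum_mul, Finset.smul_sum]
  refine Fintype.sum_equiv (Equiv.mulRight ⟨u, hu⟩) _ _ fun w => ?_
  rw [Equiv.coe_mulRight, smul_mul_assoc, ← map_mul, smul_smul, Subgroup.coe_mul,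
    whittakerChar_mul ψ w.2 hu, _root_.mul_inv_rev, mul_inv_cancel_left₀ (whittakerChar_ne_zero _ _)]

theorem of_mul_whittakerElt {u : GL (Fin n) K} (hu : u ∈ unipotentSubgroup n K) :
    MonoidAlgebra.of ℂ _ u * whittakerElt ψ = whittakerChar ψ u.val • whittakerElt ψ := by
  rw [whittakerElt, Finset.mul_sum, Finset.smul_sum]
  refine Fintype.sum_equiv (Equiv.mulLeft ⟨u, hu⟩) _ _ fun w => ?_
  rw [Equiv.coe_mulLeft, mul_smul_comm, ← map_mul, smul_smul, Subgroup.coe_mul,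
    whittakerChar_mul ψ hu w.2, _root_.mul_inv, mul_inv_cancel_left₀ (whittakerChar_ne_zero _ _)]

theorem antitransposeAlgHom_whittakerElt :
    antitransposeAlgHom (whittakerElt (n := n) ψ) = MulOpposite.op (whittakerElt ψ) := by
  have he : ∀ u ∈ unipotentSubgroup n K, antitranspose u ∈ unipotentSubgroup n K :=
    fun _ => antitranspose_mem_unipotent
  rw [whittakerElt, map_sum, Finset.op_sum]
  refine Fintype.sum_equiv
    { toFun := fun u => ⟨antitranspose u.val, he _ u.2⟩
      invFun := fun u => ⟨antitranspose u.val, he _ u.2⟩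
      left_inv := fun u => Subtype.ext (antitranspose_antitranspose _)
      right_inv := fun u => Subtype.ext (antitranspose_antitranspose _) } _ _ fun u => ?_
  rw [map_smul, antitransposeAlgHom_of, Equiv.coe_fn_mk, whittakerChar_antitranspose,
    MulOpposite.op_smul]

/-- If a monomial matrix has a nonzero image in the Gelfand–Graev Hecke algebra, then it is fixed by
`antitranspose`. -/
theorem antitranspose_eq_self_of_monomial (hψ : ψ ≠ 1) {m : GL (Fin n) K}
    {σ : Equiv.Perm (Fin n)} {t : Fin n → K} (ht : ∀ j, t j ≠ 0)
    (hm : ∀ i j, m.val i j = if i = σ j then t j else 0)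
    (hne : whittakerElt ψ * MonoidAlgebra.of ℂ _ m * whittakerElt ψ ≠ 0) :
    antitranspose m = m := by
  -- compare the characters of a root subgroup and of its conjugate by `m`
  have hroot : ∀ i j : Fin n, i < j → σ i < σ j →
      (if i.val + 1 = j.val then t j else 0) = if (σ i).val + 1 = (σ j).val then t i else 0 := by
    intro i j hij hσ
    refine eq_of_forall_addChar_mul_eq hψ fun x => ?_
    have hconj : m * colUnip j (Pi.single i (x * t j)) =
        colUnip (σ j) (Pi.single (σ i) (x * t i)) * m := by
      refine Units.ext ?_
      rw [Units.val_mul, Units.val_mul, colUnip_val, colUnip_val, trunc_single hij,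
        trunc_single hσ, mul_add, add_mul, mul_one, one_mul, Matrix.mul_vecMulVec,
        Matrix.vecMulVec_mul]
      congr 1
      ext a b
      rw [Matrix.vecMulVec_apply, Matrix.vecMulVec_apply, Matrix.single_one_vecMul,
        Matrix.row_apply, Matrix.mulVec, dotProduct_single, hm, hm]
      simp only [Pi.single_apply, EmbeddingLike.apply_eq_iff_eq]
      by_cases h2 : b = j
      · subst h2
        by_cases h1 : a = σ i
        · simp [h1]; ring
        · simp [h1]
      · simp [h2, Ne.symm h2]
    have h1 : whittakerElt ψ * MonoidAlgebra.of ℂ _ (m * colUnip j (Pi.single i (x * t j))) *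
        whittakerElt ψ = whittakerElt ψ *
          MonoidAlgebra.of ℂ _ (colUnip (σ j) (Pi.single (σ i) (x * t i)) * m) *
        whittakerElt ψ := by rw [hconj]
    rw [map_mul, map_mul, ← mul_assoc, ← mul_assoc, whittakerElt_mul_of (colUnip_mem_unipotent _ _),
      mul_assoc (_ * _), of_mul_whittakerElt (colUnip_mem_unipotent _ _), mul_smul_comm,
      smul_mul_assoc, smul_mul_assoc, whittakerChar_colUnip, whittakerChar_colUnip,
      prevCoord_single, prevCoord_single] at h1
    have h2 := smul_left_injective ℂ hne h1
    rw [mul_ite, mul_ite, mul_zero]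
    exact h2
  have hinvol := involutive_of_inversions (σ.trans Fin.revPerm) t (by
    intro i j hij hρ
    simp only [Equiv.trans_apply, Fin.revPerm_apply, Fin.rev_lt_rev] at hρ
    have h := hroot i j hij hρ
    simp only [Equiv.trans_apply, Fin.revPerm_apply, Fin.val_rev]
    have hi := (σ i).isLt
    have hj := (σ j).isLt
    rw [Fin.lt_def] at hρ
    by_cases h1 : i.val + 1 = j.val <;> by_cases h2 : (σ i).val + 1 = (σ j).val
    · rw [if_pos h1, if_pos h2] at h
      exact ⟨⟨fun _ => by omega, fun _ => h1⟩, fun _ => h.symm⟩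
    · rw [if_pos h1, if_neg h2] at h
      exact absurd h (ht j)
    · rw [if_neg h1, if_pos h2] at h
      exact absurd h.symm (ht i)
    · exact ⟨⟨fun h => absurd h h1, fun h => by omega⟩, fun h => absurd h h1⟩)
  simp only [Equiv.trans_apply, Fin.revPerm_apply] at hinvol
  refine Units.ext ?_
  ext a b
  rw [antitranspose_apply, hm, hm]
  by_cases h : a = σ b
  · rw [if_pos h, if_pos]
    · rw [h, (hinvol b).2]
    · rw [h, Fin.rev_eq_iff.mp (hinvol b).1]
  · rw [if_neg h, if_neg]
    intro h'
    have h1 := (hinvol a.rev).1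
    rw [← h', Fin.rev_rev] at h1
    exact h (Fin.rev_injective h1).symm

theorem sandwich_antitranspose (hψ : ψ ≠ 1) (g : GL (Fin n) K) :
    whittakerElt ψ * MonoidAlgebra.of ℂ _ (antitranspose g) * whittakerElt ψ =
      whittakerElt ψ * MonoidAlgebra.of ℂ _ g * whittakerElt ψ := by
  have hred : ∀ u₁ ∈ unipotentSubgroup n K, ∀ u₂ ∈ unipotentSubgroup n K, ∀ m : GL (Fin n) K,
      whittakerElt ψ * MonoidAlgebra.of ℂ _ (u₁ * m * u₂) * whittakerElt ψ =
        (whittakerChar ψ u₁.val * whittakerChar ψ u₂.val) •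
          (whittakerElt ψ * MonoidAlgebra.of ℂ _ m * whittakerElt ψ) := by
    intro u₁ h₁ u₂ h₂ m
    rw [map_mul, map_mul, ← mul_assoc, ← mul_assoc, whittakerElt_mul_of h₁, mul_assoc (_ * _),
      of_mul_whittakerElt h₂, mul_smul_comm, smul_mul_assoc, smul_mul_assoc, smul_smul, mul_comm]
  obtain ⟨u₁, h₁, u₂, h₂, σ, t, ht, hm⟩ := exists_unipotent_mul_mul_eq_monomial g
  set m := u₁ * g * u₂ with hmdef
  have hmono : whittakerElt ψ * MonoidAlgebra.of ℂ _ (antitranspose m) * whittakerElt ψ =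
      whittakerElt ψ * MonoidAlgebra.of ℂ _ m * whittakerElt ψ := by
    by_cases hne : whittakerElt ψ * MonoidAlgebra.of ℂ _ m * whittakerElt ψ = 0
    · have h := congrArg antitransposeAlgHom hne
      rw [map_mul, map_mul, antitransposeAlgHom_whittakerElt, antitransposeAlgHom_of,
        ← MulOpposite.op_mul, ← MulOpposite.op_mul, map_zero, MulOpposite.op_eq_zero_iff,
        ← mul_assoc] at h
      rw [h, hne]
    · rw [antitranspose_eq_self_of_monomial hψ ht hm hne]
  rw [hmdef, antitranspose_mul, antitranspose_mul, ← mul_assoc,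
    hred _ (antitranspose_mem_unipotent h₂) _ (antitranspose_mem_unipotent h₁), hred _ h₁ _ h₂,
    whittakerChar_antitranspose, whittakerChar_antitranspose, mul_comm (whittakerChar ψ u₂.val)]
    at hmono
  exact smul_right_injective _
    (mul_ne_zero (whittakerChar_ne_zero _ _) (whittakerChar_ne_zero _ _)) hmono

/-- The element `e x e` of the Gelfand–Graev Hecke algebra `e ℂ[G] e`. -/
def sandwich (ψ : AddChar K ℂ) (x : MonoidAlgebra ℂ (GL (Fin n) K)) :
    MonoidAlgebra ℂ (GL (Fin n) K) :=
  whittakerElt ψ * x * whittakerElt ψ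

theorem antitransposeAlgHom_sandwich (hψ : ψ ≠ 1) (x : MonoidAlgebra ℂ (GL (Fin n) K)) :
    antitransposeAlgHom (sandwich ψ x) = MulOpposite.op (sandwich ψ x) := by
  rw [sandwich, map_mul, map_mul, antitransposeAlgHom_whittakerElt]
  induction x using MonoidAlgebra.induction_on with
  | of g =>
    rw [antitransposeAlgHom_of, ← MulOpposite.op_mul, ← MulOpposite.op_mul, ← mul_assoc,
      sandwich_antitranspose hψ]
  | add x y hx hy =>
    rw [map_add, mul_add, add_mul, hx, hy, mul_add, add_mul, MulOpposite.op_add]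
  | smul c x hx =>
    rw [map_smul, mul_smul_comm, smul_mul_assoc, hx, mul_smul_comm, smul_mul_assoc,
      MulOpposite.op_smul]

/-- Gelfand's trick: an algebra whose elements are all fixed by an anti-automorphism is
commutative. -/
theorem sandwich_mul_comm (hψ : ψ ≠ 1) (x y : MonoidAlgebra ℂ (GL (Fin n) K)) :
    sandwich ψ x * sandwich ψ y = sandwich ψ y * sandwich ψ x := by
  have hxy : sandwich ψ x * sandwich ψ y = sandwich ψ (x * whittakerElt ψ * whittakerElt ψ * y) := by
    simp only [sandwich, mul_assoc]
  have h := antitransposeAlgHom_sandwich hψ (x * whittakerElt ψ * whittakerElt ψ * y)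
  rw [← hxy, map_mul, antitransposeAlgHom_sandwich hψ, antitransposeAlgHom_sandwich hψ,
    ← MulOpposite.op_mul] at h
  exact (MulOpposite.op_injective h).symm

variable {V : Type*} [AddCommGroup V] [Module ℂ V] {π : Representation ℂ (GL (Fin n) K) V}

theorem asAlgebraHom_whittakerElt_of_mem {v : V} (hv : IsWhittakerVector π ψ v) :
    π.asAlgebraHom (whittakerElt ψ) v = (Fintype.card (unipotentSubgroup n K) : ℂ) • v := by
  rw [whittakerElt, map_sum, LinearMap.sum_apply, Finset.sum_congr rfl (g := fun _ => v),
    Finset.sum_const, Finset.card_univ, Nat.cast_smul_eq_nsmul]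
  intro u _
  rw [map_smul, LinearMap.smul_apply, Representation.asAlgebraHom_of, hv u.val u.2, smul_smul,
    inv_mul_cancel₀ (whittakerChar_ne_zero _ _), one_smul]

theorem isWhittakerVector_asAlgebraHom_whittakerElt (v : V) :
    IsWhittakerVector π ψ (π.asAlgebraHom (whittakerElt ψ) v) := by
  intro u hu
  rw [← Representation.asAlgebraHom_of, ← Module.End.mul_apply, ← map_mul,
    of_mul_whittakerElt hu, map_smul, LinearMap.smul_apply]

/-- Uniqueness of Whittaker vectors in an irreducible representation. -/
theorem exists_eq_smul_of_isWhittakerVector [Finite K] (hψ : ψ ≠ 1) (hirr : π.IsIrreducible)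
    {v w : V} (hv : IsWhittakerVector π ψ v) (hv0 : v ≠ 0) (hw : IsWhittakerVector π ψ w) :
    ∃ c : ℂ, w = c • v := by
  have : FiniteDimensional ℂ V := finiteDimensional_of_isIrreducible hirr
  have hN : (Fintype.card (unipotentSubgroup n K) : ℂ) ≠ 0 := by
    exact_mod_cast Fintype.card_ne_zero
  have happly : ∀ x v, π.asAlgebraHom (sandwich ψ x) v =
      π.asAlgebraHom (whittakerElt ψ) (π.asAlgebraHom x (π.asAlgebraHom (whittakerElt ψ) v)) := by
    intro x v
    rw [sandwich, map_mul, map_mul]; rfl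
  -- the Hecke algebra acts transitively on the nonzero Whittaker vectors
  have htrans : ∀ a, IsWhittakerVector π ψ a → a ≠ 0 → ∀ b, IsWhittakerVector π ψ b →
      ∃ x, π.asAlgebraHom (sandwich ψ x) a = b := by
    intro a ha ha0 b hb
    obtain ⟨x, hx⟩ := exists_asAlgebraHom_eq hirr
      (v := (Fintype.card (unipotentSubgroup n K) : ℂ) • a) (smul_ne_zero hN ha0) ((Fintype.card (unipotentSubgroup n K) : ℂ)⁻¹ • b)
    refine ⟨x, ?_⟩
    rw [happly, asAlgebraHom_whittakerElt_of_mem ha, hx, map_smul,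
      asAlgebraHom_whittakerElt_of_mem hb, smul_smul, inv_mul_cancel₀ hN, one_smul]
  obtain ⟨x, hx⟩ := htrans v hv hv0 w hw
  -- an eigenvector of one element of a commutative algebra, translated to `v` by another
  let T : Module.End ℂ (whittakerVectors π ψ) :=
    (π.asAlgebraHom (sandwich ψ x)).restrict (p := whittakerVectors π ψ)
      (fun a _ => by rw [happly]; exact isWhittakerVector_asAlgebraHom_whittakerElt _)
  have : Nontrivial (whittakerVectors π ψ) :=
    ⟨⟨⟨v, hv⟩, 0, fun h => hv0 (congrArg Subtype.val h)⟩⟩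
  obtain ⟨c, hc⟩ := Module.End.exists_eigenvalue T
  obtain ⟨s, hs⟩ := hc.exists_hasEigenvector
  have hTs : π.asAlgebraHom (sandwich ψ x) s.val = c • s.val := congrArg Subtype.val hs.apply_eq_smul
  obtain ⟨y, hy⟩ := htrans s.val s.2 (fun h => hs.2 (Subtype.ext h)) v hv
  refine ⟨c, ?_⟩
  rw [← hx, ← hy, ← Module.End.mul_apply, ← map_mul, sandwich_mul_comm hψ, map_mul,
    Module.End.mul_apply, hTs, map_smul]

end GelfandGraev

/-! ### Whittaker functionals on the mirabolic subgroup -/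

section WhittakerFunctional

variable {n : ℕ} {K : Type*} [Field K]

theorem inv_unipotent_rows {k : ℕ} {p : GL (Fin n) K}
    (h : ∀ i j : Fin n, k ≤ i.val → j ≤ i → p.val i j = (1 : Matrix (Fin n) (Fin n) K) i j) :
    ∀ i j : Fin n, k ≤ i.val → j ≤ i → (p⁻¹).val i j = (1 : Matrix (Fin n) (Fin n) K) i j := by
  -- the matrix with the rows `≥ k` of `p` and the other rows of the identity
  let a : Matrix (Fin n) (Fin n) K := fun i j =>
    if k ≤ i.val then p.val i j else (1 : Matrix (Fin n) (Fin n) K) i j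
  have ha : ∀ i j : Fin n, j ≤ i → a i j = (1 : Matrix (Fin n) (Fin n) K) i j := by
    intro i j hij
    change (if k ≤ i.val then p.val i j else _) = _
    split_ifs with hk
    · exact h i j hk hij
    · rfl
  have main : ∀ m : ℕ, ∀ i : Fin n, n - i.val ≤ m → ∀ j : Fin n, k ≤ i.val → j ≤ i →
      (p⁻¹).val i j = (1 : Matrix (Fin n) (Fin n) K) i j := by
    intro m
    induction m with
    | zero => intro i hi; have := i.isLt; omega
    | succ m ih =>
      intro i hi j hk hij
      have h1 : (a * (p⁻¹).val) i j = (1 : Matrix (Fin n) (Fin n) K) i j := by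
        have h2 : (p.val * (p⁻¹).val) i j = (1 : Matrix (Fin n) (Fin n) K) i j := by
          rw [← Units.val_mul, mul_inv_cancel]; rfl
        rw [← h2, Matrix.mul_apply, Matrix.mul_apply]
        refine Finset.sum_congr rfl fun l _ => ?_
        congr 1
        exact if_pos hk
      rw [unipotent_mul_apply ha i j, Finset.sum_eq_zero, add_zero] at h1
      · exact h1
      · intro l hl
        have hl' : i < l := by simpa using hl
        have hlv : i.val < l.val := hl'
        rw [ih l (by omega) j (by omega) (hij.trans hl'.le),
          Matrix.one_apply_ne (hij.trans_lt hl').ne', mul_zero]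
  exact fun i j => main _ i le_rfl j

variable {V : Type*} [AddCommGroup V] [Module ℂ V] {π : Representation ℂ (GL (Fin n) K) V}
  {ψ : AddChar K ℂ}

/-- On the mirabolic subgroup, the Whittaker function of a Whittaker vector is supported on the
unipotent subgroup. -/
theorem mem_unipotent_of_apply_ne_zero [NeZero n] (hψ : ψ ≠ 1) {ℓ : Module.Dual ℂ V}
    (hℓ : IsWhittakerFunctional π ψ ℓ) {v : V} (hv : IsWhittakerVector π ψ v) {p : GL (Fin n) K}
    (hp : p ∈ mirabolic n K) (hne : ℓ (π p v) ≠ 0) : p ∈ unipotentSubgroup n K := by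
  suffices h : ∀ m : ℕ, ∀ i j : Fin n, n ≤ i.val + m → j ≤ i →
      p.val i j = (1 : Matrix (Fin n) (Fin n) K) i j from
    fun i j hij => h n i j (by omega) hij
  intro m
  induction m with
  | zero => intro i; have := i.isLt; omega
  | succ m ih =>
    intro k l hk hlk
    by_cases hlast : k.val + 1 = n
    · have hkl : k = lastIdx n := Fin.ext (by rw [lastIdx, Fin.val_rev, Fin.val_zero]; omega)
      have h1 : p.val (lastIdx n) = eLast n K := hp
      rw [hkl, h1, eLast, Matrix.one_apply, Pi.single_apply]
      simp [eq_comm]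
    · obtain ⟨j, hj⟩ : ∃ j : Fin n, k.val + 1 = j.val :=
        ⟨⟨k.val + 1, by have := k.isLt; omega⟩, rfl⟩
      have hrows : ∀ i l : Fin n, j.val ≤ i.val → l ≤ i →
          p.val i l = (1 : Matrix (Fin n) (Fin n) K) i l := fun i l hi => ih i l (by omega)
      have hinv := inv_unipotent_rows hrows
      have hlj : l < j := by rw [Fin.lt_def]; rw [Fin.le_def] at hlk; omega
      -- compare the characters of a root subgroup in column `j` and of its conjugate by `p`
      have hchar : ∀ c, ψ (c * if l.val + 1 = j.val then 1 else 0) = ψ (c * p.val k l) := by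
        intro c
        obtain ⟨u, hu⟩ : ∃ u, u = p * colUnip j (Pi.single l c) * p⁻¹ := ⟨_, rfl⟩
        have huval : u.val = 1 + Matrix.vecMulVec (p.val *ᵥ Pi.single l c) ((p⁻¹).val j) := by
          rw [hu, Units.val_mul, Units.val_mul, colUnip_val, trunc_single hlj, mul_add, mul_one,
            add_mul, ← Units.val_mul, mul_inv_cancel, Units.val_one, Matrix.mul_vecMulVec,
            Matrix.vecMulVec_mul, Matrix.single_one_vecMul]
          rfl
        have hcol : ∀ i, j ≤ i → (p.val *ᵥ Pi.single l c) i = 0 := by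
          intro i hi
          rw [Matrix.mulVec, dotProduct_single, hrows i l hi (hlj.le.trans hi),
            Matrix.one_apply_ne (hlj.trans_le hi).ne', zero_mul]
        have hrow : ∀ i, i < j → (p⁻¹).val j i = 0 := by
          intro i hi
          rw [hinv j i le_rfl hi.le, Matrix.one_apply_ne hi.ne']
        have huN : u ∈ unipotentSubgroup n K :=
          one_add_vecMulVec_mem_unipotent (k := j) hcol hrow huval
        have h1 : ℓ (π (u * p) v) = ℓ (π (p * colUnip j (Pi.single l c)) v) := by
          rw [hu, inv_mul_cancel_right]
        rw [map_mul, map_mul, Module.End.mul_apply, Module.End.mul_apply, hℓ u huN,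
          hv _ (colUnip_mem_unipotent _ _), map_smul, map_smul, smul_eq_mul, whittakerChar_colUnip,
          huval, whittakerChar_one_add_vecMulVec ψ hcol hrow (by
            rw [hinv j j le_rfl le_rfl, Matrix.one_apply_eq]), prevCoord_eq hj, prevCoord_single,
          Matrix.mulVec, dotProduct_single] at h1
        rw [mul_ite, mul_one, mul_zero, ← mul_right_cancel₀ hne h1, mul_comm]
      rw [← eq_of_forall_addChar_mul_eq hψ hchar, Matrix.one_apply]
      by_cases h : k = l
      · subst h; rw [if_pos hj, if_pos rfl]
      · rw [if_neg h, if_neg]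
        intro h'
        exact h (Fin.ext (by omega))

/-- Uniqueness of Whittaker functionals, deduced from uniqueness of Whittaker vectors. -/
theorem exists_whittakerFunctional [Finite K] (hψ : ψ ≠ 1) (hirr : π.IsIrreducible) {v₀ : V}
    (hv₀ : IsWhittakerVector π ψ v₀) (hne : v₀ ≠ 0) :
    ∃ ℓ₀ : Module.Dual ℂ V, IsWhittakerFunctional π ψ ℓ₀ ∧ ℓ₀ v₀ = 1 ∧
      ∀ ℓ : Module.Dual ℂ V, IsWhittakerFunctional π ψ ℓ → ℓ = ℓ v₀ • ℓ₀ := by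
  let _ : Fintype (unipotentSubgroup n K) := Fintype.ofFinite _
  have hN : (Fintype.card (unipotentSubgroup n K) : ℂ) ≠ 0 := by
    exact_mod_cast Fintype.card_ne_zero
  obtain ⟨f, hf⟩ := Module.Projective.exists_dual_eq_one ℂ hne
  set N := (Fintype.card (unipotentSubgroup n K) : ℂ)
  set ε := π.asAlgebraHom (whittakerElt ψ) with hε
  have hεv : ∀ v, ε v = f (ε v) • v₀ := by
    intro v
    obtain ⟨c, hc⟩ := exists_eq_smul_of_isWhittakerVector hψ hirr hv₀ hne
      (isWhittakerVector_asAlgebraHom_whittakerElt v)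
    rw [hε, hc, map_smul, hf, smul_eq_mul, mul_one]
  refine ⟨N⁻¹ • f.comp ε, fun u hu v => ?_, ?_, fun ℓ hℓ => LinearMap.ext fun v => ?_⟩
  · have h1 : ε (π u v) = whittakerChar ψ u.val • ε v := by
      rw [hε, ← Representation.asAlgebraHom_of, ← Module.End.mul_apply, ← map_mul,
        whittakerElt_mul_of hu, map_smul, LinearMap.smul_apply]
    simp only [LinearMap.smul_apply, LinearMap.comp_apply, h1, map_smul, smul_eq_mul]
    ring
  · rw [LinearMap.smul_apply, LinearMap.comp_apply, hε, asAlgebraHom_whittakerElt_of_mem hv₀,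
      map_smul, hf, smul_eq_mul, smul_eq_mul, mul_one, inv_mul_cancel₀ hN]
  · have h1 : ℓ (ε v) = N * ℓ v := by
      rw [hε, whittakerElt, map_sum, LinearMap.sum_apply, map_sum,
        Finset.sum_congr rfl (g := fun _ => ℓ v), Finset.sum_const, Finset.card_univ, nsmul_eq_mul]
      intro u _
      rw [map_smul, LinearMap.smul_apply, Representation.asAlgebraHom_of, map_smul, hℓ u.val u.2,
        smul_eq_mul, inv_mul_cancel_left₀ (whittakerChar_ne_zero _ _)]
    rw [hεv, map_smul, smul_eq_mul] at h1
    simp only [LinearMap.smul_apply, LinearMap.comp_apply, smul_eq_mul]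
    field_simp
    linear_combination -h1

theorem exists_eq_of_mem_whittakerModel {v₀ : V} {ℓ₀ : Module.Dual ℂ V}
    (huniq : ∀ ℓ : Module.Dual ℂ V, IsWhittakerFunctional π ψ ℓ → ℓ = ℓ v₀ • ℓ₀)
    {W : GL (Fin n) K → ℂ} (hW : W ∈ whittakerModel π ψ) : ∃ v, ∀ g, W g = ℓ₀ (π g v) := by
  induction hW using Submodule.span_induction with
  | mem W h =>
    obtain ⟨ℓ, hℓ, v, hW⟩ := h
    refine ⟨ℓ v₀ • v, fun g => ?_⟩
    rw [hW, map_smul, map_smul]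
    exact LinearMap.congr_fun (huniq ℓ hℓ) _
  | zero => exact ⟨0, fun g => by simp⟩
  | add W W' _ _ hW hW' =>
    obtain ⟨v, hv⟩ := hW
    obtain ⟨v', hv'⟩ := hW'
    exact ⟨v + v', fun g => by rw [Pi.add_apply, hv, hv', map_add, map_add]⟩
  | smul c W _ hW =>
    obtain ⟨v, hv⟩ := hW
    exact ⟨c • v, fun g => by rw [Pi.smul_apply, hv, map_smul, map_smul]⟩

end WhittakerFunctional

/-! ### Equivariant sums over `GL_n(F)` -/

section Zeta

variable {n : ℕ} {F : Type*} [Field F]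

open Classical in
/-- The delta function at `y`. -/
def delta (y : Fin n → F) : (Fin n → F) → ℂ := fun x => if x = y then 1 else 0

/-- The linear map `φ ↦ (g ↦ φ(eₙ g))`. -/
def evalLast (n : ℕ) [NeZero n] (F : Type*) [Field F] :
    ((Fin n → F) → ℂ) →ₗ[ℂ] (GL (Fin n) F → ℂ) :=
  LinearMap.funLeft ℂ ℂ fun g => eLast n F ᵥ* g.val

/-- The linear map `φ ↦ (g ↦ 𝓕φ(e₁ ᵗg⁻¹))`. -/
def fourierEvalFirst (n : ℕ) [NeZero n] {F : Type*} [Field F] [Fintype F] (ψ : AddChar F ℂ) :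
    ((Fin n → F) → ℂ) →ₗ[ℂ] (GL (Fin n) F → ℂ) where
  toFun φ g := finiteFourier ψ φ (eFirst n F ᵥ* (g⁻¹).valᵀ)
  map_add' φ φ' := by
    ext g
    simp only [finiteFourier, Pi.add_apply, add_mul, Finset.sum_add_distrib, mul_add]
  map_smul' c φ := by
    ext g
    simp only [finiteFourier, Pi.smul_apply, smul_eq_mul, mul_assoc, ← Finset.mul_sum,
      RingHom.id_apply]
    ring

/-- `Φ` intertwines the action of `GL_n(F)` on functions on `F^n` with right translation. -/
def IsEquivariant (Φ : ((Fin n → F) → ℂ) →ₗ[ℂ] (GL (Fin n) F → ℂ)) : Prop :=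
  ∀ (h g : GL (Fin n) F) (φ : (Fin n → F) → ℂ), Φ (fun x => φ (x ᵥ* h.val)) g = Φ φ (g * h)

theorem isEquivariant_evalLast [NeZero n] : IsEquivariant (evalLast n F) := by
  intro h g φ
  change φ ((eLast n F ᵥ* g.val) ᵥ* h.val) = φ (eLast n F ᵥ* (g * h).val)
  rw [Matrix.vecMul_vecMul, Units.val_mul]

theorem isEquivariant_fourierEvalFirst [NeZero n] [Fintype F] (ψ : AddChar F ℂ) :
    IsEquivariant (fourierEvalFirst n ψ) := by
  intro h g φ
  change finiteFourier ψ _ (eFirst n F ᵥ* (g⁻¹).valᵀ) =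
    finiteFourier ψ φ (eFirst n F ᵥ* ((g * h)⁻¹).valᵀ)
  rw [finiteFourier, finiteFourier]
  congr 1
  have h1 : ∀ x : Fin n → F, (x ᵥ* h.val) ᵥ* (h⁻¹).val = x := fun x => by
    rw [Matrix.vecMul_vecMul, ← Units.val_mul, mul_inv_cancel, Units.val_one, Matrix.vecMul_one]
  have h2 : ∀ x : Fin n → F, (x ᵥ* (h⁻¹).val) ᵥ* h.val = x := fun x => by
    rw [Matrix.vecMul_vecMul, ← Units.val_mul, inv_mul_cancel, Units.val_one, Matrix.vecMul_one]
  refine Fintype.sum_equiv ⟨fun x => x ᵥ* h.val, fun x => x ᵥ* (h⁻¹).val, h1, h2⟩ _ _ fun x => ?_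
  rw [Equiv.coe_fn_mk, _root_.mul_inv_rev, Units.val_mul, Matrix.transpose_mul,
    ← Matrix.vecMul_vecMul, Matrix.vecMul_transpose (h⁻¹).val,
    Matrix.dotProduct_mulVec, h1]

theorem exists_eLast_vecMul_eq [NeZero n] {y : Fin n → F} (hy : y ≠ 0) :
    ∃ g : GL (Fin n) F, eLast n F ᵥ* g.val = y := by
  obtain ⟨g, -, hg⟩ := exists_row_eq (k := n) (l := lastIdx n)
    (by rw [lastIdx, Fin.val_rev, Fin.val_zero]; have := NeZero.pos n; omega) (y := y)
    (fun i hi => absurd i.isLt hi.not_gt) hy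
  exact ⟨g, hg⟩

theorem vecMul_injective_of_unit (h : GL (Fin n) F) :
    Function.Injective fun x : Fin n → F => x ᵥ* h.val :=
  Matrix.vecMul_injective_of_isUnit h.isUnit

theorem delta_vecMul {h : GL (Fin n) F} {y z : Fin n → F} (hyz : y ᵥ* h.val = z) :
    (fun x => delta z (x ᵥ* h.val)) = delta y := by
  ext x
  have hx : x ᵥ* h.val = z ↔ x = y := by
    rw [← hyz]; exact (vecMul_injective_of_unit h).eq_iff
  by_cases hxy : x = y
  · exact (if_pos (hx.mpr hxy)).trans (if_pos hxy).symm
  · exact (if_neg (mt hx.mp hxy)).trans (if_neg hxy).symm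

variable {E : Type*} [Field E] [Algebra F E] {V : Type*} [AddCommGroup V] [Module ℂ V]

/-- The bilinear form `∑_g ℓ(π(g)v) Φ(φ)(g)`, the sum being over `GL_n(F)`. -/
def zetaForm [Fintype (GL (Fin n) F)] (π : Representation ℂ (GL (Fin n) E) V)
    (ℓ : Module.Dual ℂ V) (Φ : ((Fin n → F) → ℂ) →ₗ[ℂ] (GL (Fin n) F → ℂ))
    (φ : (Fin n → F) → ℂ) : V →ₗ[ℂ] ℂ :=
  ∑ g : GL (Fin n) F, Φ φ g • ℓ.comp (π (glIncl n F E g))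

variable [Fintype (GL (Fin n) F)] {π : Representation ℂ (GL (Fin n) E) V} {ℓ : Module.Dual ℂ V}
  {Φ : ((Fin n → F) → ℂ) →ₗ[ℂ] (GL (Fin n) F → ℂ)}

theorem zetaForm_apply (φ : (Fin n → F) → ℂ) (v : V) :
    zetaForm π ℓ Φ φ v = ∑ g : GL (Fin n) F, ℓ (π (glIncl n F E g) v) * Φ φ g := by
  rw [zetaForm, LinearMap.sum_apply]
  refine Finset.sum_congr rfl fun g _ => ?_
  rw [LinearMap.smul_apply, LinearMap.comp_apply, smul_eq_mul, mul_comm]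

theorem zetaForm_translate (hΦ : IsEquivariant Φ) (h : GL (Fin n) F) (φ : (Fin n → F) → ℂ)
    (v : V) : zetaForm π ℓ Φ (fun x => φ (x ᵥ* h.val)) (π (glIncl n F E h) v) =
      zetaForm π ℓ Φ φ v := by
  rw [zetaForm_apply, zetaForm_apply]
  refine Fintype.sum_equiv (Equiv.mulRight h) _ _ fun g => ?_
  rw [hΦ, Equiv.coe_mulRight, map_mul, map_mul, Module.End.mul_apply]

/-- An equivariant form is determined, on the functions vanishing at the origin, by its value on a
Whittaker vector and the delta function at `eₙ`: the origin is the only other orbit of `GL_n(F)`,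
the stabiliser of `eₙ` is the mirabolic subgroup, and the invariant functionals of the latter are
determined on Whittaker vectors. -/
theorem zetaForm_eq_zero [NeZero n] [Fintype F] [Fintype E] {ψE : AddChar E ℂ}
    (hEF : Module.finrank F E = 2) (hψE : ψE ≠ 1)
    (hψEF : ∀ x : F, ψE (algebraMap F E x) = 1) (hcusp : IsCuspidal π) (hΦ : IsEquivariant Φ)
    (hW : ∀ v, IsWhittakerVector π ψE v → zetaForm π ℓ Φ (delta (eLast n F)) v = 0)
    {φ : (Fin n → F) → ℂ} (hφ : φ 0 = 0) (v : V) : zetaForm π ℓ Φ φ v = 0 := by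
  classical
  have h0 : zetaForm π ℓ Φ (delta (eLast n F)) = 0 := by
    refine eq_zero_of_mirabolic_invariant hEF hψE hψEF hcusp _ (fun h hh w => ?_) hW
    have hfix : eLast n F ᵥ* h.val = eLast n F := by
      rw [eLast, Matrix.single_one_vecMul]; exact hh
    have := zetaForm_translate (π := π) (ℓ := ℓ) hΦ h (delta (eLast n F)) w
    rwa [delta_vecMul hfix] at this
  have h1 : ∀ y : Fin n → F, y ≠ 0 → ∀ w, zetaForm π ℓ Φ (delta y) w = 0 := by
    intro y hy w
    obtain ⟨h, hh⟩ := exists_eLast_vecMul_eq hy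
    rw [← zetaForm_translate hΦ h, delta_vecMul hh, h0, LinearMap.zero_apply]
  have hsum : φ = ∑ y, φ y • (delta y : (Fin n → F) → ℂ) := by
    ext x
    simp [Finset.sum_apply, delta]
  have hlin : zetaForm π ℓ Φ φ v = ∑ y, φ y * zetaForm π ℓ Φ (delta y) v := by
    conv_lhs => rw [hsum]
    simp only [zetaForm_apply, map_sum, map_smul, Finset.sum_apply, Pi.smul_apply, smul_eq_mul,
      Finset.mul_sum]
    rw [Finset.sum_comm]
    refine Finset.sum_congr rfl fun y _ => Finset.sum_congr rfl fun g _ => ?_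
    ring
  rw [hlin]
  refine Finset.sum_eq_zero fun y _ => ?_
  by_cases hy : y = 0
  · rw [hy, hφ, zero_mul]
  · rw [h1 y hy, mul_zero]

/-- The Flicker form does not vanish at a Whittaker vector and the delta function at `eₙ`: the sum
runs over the mirabolic subgroup, and the summand is the indicator function of the unipotent
subgroup. -/
theorem zetaForm_evalLast_ne_zero [NeZero n] {ψE : AddChar E ℂ} (hψE : ψE ≠ 1)
    (hψEF : ∀ x : F, ψE (algebraMap F E x) = 1) (hℓ : IsWhittakerFunctional π ψE ℓ) {v₀ : V}
    (hv₀ : IsWhittakerVector π ψE v₀) (h1 : ℓ v₀ = 1) :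
    zetaForm π ℓ (evalLast n F) (delta (eLast n F)) v₀ ≠ 0 := by
  classical
  have hterm : ∀ g : GL (Fin n) F, ℓ (π (glIncl n F E g) v₀) *
      evalLast n F (delta (eLast n F)) g =
        if g ∈ unipotentSubgroup n F then (1 : ℂ) else 0 := by
    intro g
    have hev : evalLast n F (delta (eLast n F)) g =
        delta (eLast n F) (eLast n F ᵥ* g.val) := rfl
    split_ifs with hg
    · rw [hev, eLast_vecMul_unipotent hg, delta, if_pos rfl, mul_one,
        hv₀ _ (glIncl_mem_unipotent hg), whittakerChar_glIncl ψE hψEF, one_smul, h1]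
    · by_cases hgP : eLast n F ᵥ* g.val = eLast n F
      · rw [mul_eq_zero]
        left
        by_contra hne
        have hP : g.val (lastIdx n) = Pi.single (lastIdx n) 1 := by
          rw [eLast, Matrix.single_one_vecMul] at hgP; exact hgP
        have hN := mem_unipotent_of_apply_ne_zero hψE hℓ hv₀ (glIncl_row_of_row hP) hne
        refine hg fun i j hij => (algebraMap F E).injective ?_
        have h2 := hN i j hij
        rw [glIncl, Matrix.GeneralLinearGroup.map_apply] at h2
        rw [h2, Matrix.one_apply, Matrix.one_apply]
        split_ifs <;> simp
      · rw [hev, delta, if_neg hgP, mul_zero]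
  rw [zetaForm_apply, Finset.sum_congr rfl fun g _ => hterm g, ← Finset.sum_filter,
    Finset.sum_const, nsmul_one, Nat.cast_ne_zero, Finset.card_ne_zero]
  exact ⟨1, Finset.mem_filter.mpr ⟨Finset.mem_univ _, one_mem _⟩⟩

end Zeta

end FiniteAsai

end

/-! ### Multiplicity one and the gamma factor -/

open FiniteAsai
theorem mainTheorem10 {F E : Type*} [Field F] [Fintype F] [Field E] [Algebra F E]
    (hEF : Module.finrank F E = 2) (n : ℕ) [NeZero n]
    (ψ : AddChar F ℂ) (hψ : ψ ≠ 1)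
    (ψE : AddChar E ℂ) (hψE : ψE ≠ 1) (hψEF : ∀ x : F, ψE (algebraMap F E x) = 1)
    {V : Type*} [AddCommGroup V] [Module ℂ V] (π : Representation ℂ (GL (Fin n) E) V)
    (hirr : π.IsIrreducible) (hcusp : IsCuspidal π) :
    Module.rank ℂ (MirabolicHom F π) ≤ 1 ∧
    ∃! γ : ℂ, ∀ W ∈ whittakerModel π ψE, ∀ φ : (Fin n → F) → ℂ, φ 0 = 0 →
      γ * cosetSum (unipotentSubgroup n F)
          (fun g => W (glIncl n F E g) * φ (eLast n F ᵥ* g.val)) =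
        cosetSum (unipotentSubgroup n F)
          (fun g => W (glIncl n F E g) * finiteFourier ψ φ (eFirst n F ᵥ* (g⁻¹).valᵀ)) := by
  have hfin : Module.Finite F E := Module.finite_of_finrank_pos (by omega)
  have : Finite E := Module.finite_of_finite F
  let _ : Fintype E := Fintype.ofFinite E
  let _ : Fintype (GL (Fin n) F) := Fintype.ofFinite _
  let _ : Fintype (unipotentSubgroup n E) := Fintype.ofFinite _
  have hV : Nontrivial V := by
    by_contra h
    rw [not_nontrivial_iff_subsingleton] at h
    refine (bot_ne_top : (⊥ : Subrepresentation π) ≠ ⊤) (SetLike.ext fun v => ?_)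
    rw [Subsingleton.elim v 0]
    exact ⟨fun _ => trivial, fun _ => Submodule.zero_mem _⟩
  obtain ⟨v₀, hv₀, hne⟩ := exists_isWhittakerVector_ne_zero hψE hcusp
  have hmult : ∀ w, IsWhittakerVector π ψE w → ∃ c : ℂ, w = c • v₀ :=
    fun w hw => exists_eq_smul_of_isWhittakerVector hψE hirr hv₀ hne hw
  constructor
  · -- evaluation at the Whittaker vector is injective
    let ev : MirabolicHom F π →ₗ[ℂ] ℂ :=
      { toFun := fun f => f v₀
        map_add' := fun _ _ => rfl
        map_smul' := fun _ _ => rfl }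
    have hev : Function.Injective ev := by
      rw [injective_iff_map_eq_zero]
      intro f hf
      refine Representation.IntertwiningMap.ext ?_
      refine eq_zero_of_mirabolic_invariant hEF hψE hψEF hcusp f.toLinearMap
        (fun g hg v => Representation.IntertwiningMap.isIntertwining _ _ f ⟨g, hg⟩ v) fun w hw => ?_
      obtain ⟨c, rfl⟩ := hmult w hw
      rw [map_smul]
      exact (congrArg (c • ·) hf).trans (smul_zero c)
    simpa using LinearMap.lift_rank_le_of_injective ev hev
  · obtain ⟨ℓ₀, hℓ₀, hℓv, huniq⟩ := exists_whittakerFunctional hψE hirr hv₀ hne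
    have hN : (Nat.card (unipotentSubgroup n F) : ℂ)⁻¹ ≠ 0 :=
      inv_ne_zero (by exact_mod_cast Nat.card_pos.ne')
    have hmem : ∀ v, (fun g => ℓ₀ (π g v)) ∈ whittakerModel π ψE :=
      fun v => Submodule.subset_span ⟨ℓ₀, hℓ₀, v, fun _ => rfl⟩
    have hZ : ∀ (v : V) (φ : (Fin n → F) → ℂ), cosetSum (unipotentSubgroup n F)
        (fun g => ℓ₀ (π (glIncl n F E g) v) * φ (eLast n F ᵥ* g.val)) =
          (Nat.card (unipotentSubgroup n F) : ℂ)⁻¹ * zetaForm π ℓ₀ (evalLast n F) φ v := by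
      intro v φ
      rw [cosetSum_eq _ _ (flicker_summand_invariant ψE hψEF π (hmem v) φ), zetaForm_apply]
      rfl
    have hZ' : ∀ (v : V) (φ : (Fin n → F) → ℂ), cosetSum (unipotentSubgroup n F)
        (fun g => ℓ₀ (π (glIncl n F E g) v) *
          finiteFourier ψ φ (eFirst n F ᵥ* (g⁻¹).valᵀ)) =
          (Nat.card (unipotentSubgroup n F) : ℂ)⁻¹ * zetaForm π ℓ₀ (fourierEvalFirst n ψ) φ v := by
      intro v φ
      rw [cosetSum_eq _ _ (dualFlicker_summand_invariant ψE hψEF π (hmem v) _), zetaForm_apply]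
      rfl
    set δ : (Fin n → F) → ℂ := delta (eLast n F) with hδ
    have hδ0 : δ 0 = 0 := by
      refine if_neg fun h => ?_
      have := congrFun h (lastIdx n)
      simp [eLast] at this
    have hB : zetaForm π ℓ₀ (evalLast n F) δ v₀ ≠ 0 :=
      zetaForm_evalLast_ne_zero hψE hψEF hℓ₀ hv₀ hℓv
    refine ⟨zetaForm π ℓ₀ (fourierEvalFirst n ψ) δ v₀ / zetaForm π ℓ₀ (evalLast n F) δ v₀,
      fun W hW φ hφ => ?_, fun γ' hγ' => ?_⟩
    · obtain ⟨v, hv⟩ := exists_eq_of_mem_whittakerModel huniq hW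
      simp only [hv]
      rw [hZ, hZ']
      generalize hγ : zetaForm π ℓ₀ (fourierEvalFirst n ψ) δ v₀ /
        zetaForm π ℓ₀ (evalLast n F) δ v₀ = γ
      have hsub : ∀ φ v, zetaForm π ℓ₀ (fourierEvalFirst n ψ - γ • evalLast n F) φ v =
          zetaForm π ℓ₀ (fourierEvalFirst n ψ) φ v - γ * zetaForm π ℓ₀ (evalLast n F) φ v := by
        intro φ v
        simp only [zetaForm_apply, LinearMap.sub_apply, LinearMap.smul_apply, Pi.sub_apply,
          Pi.smul_apply, smul_eq_mul, mul_sub, Finset.sum_sub_distrib, Finset.mul_sum]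
        congr 1
        exact Finset.sum_congr rfl fun g _ => by ring
      have hzero := zetaForm_eq_zero (π := π) (ℓ := ℓ₀)
        (Φ := fourierEvalFirst n ψ - γ • evalLast n F) hEF hψE hψEF hcusp
        (fun h g φ => by
          simp only [LinearMap.sub_apply, LinearMap.smul_apply, Pi.sub_apply, Pi.smul_apply]
          rw [isEquivariant_fourierEvalFirst ψ h g φ, isEquivariant_evalLast h g φ])
        (fun w hw => by
          obtain ⟨c, rfl⟩ := hmult w hw
          rw [map_smul, hsub, ← hδ, ← hγ, div_mul_cancel₀ _ hB, sub_self, smul_zero]) hφ v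
      rw [hsub] at hzero
      linear_combination -(Nat.card (unipotentSubgroup n F) : ℂ)⁻¹ * hzero
    · have h := hγ' _ (hmem v₀) δ hδ0
      rw [hZ, hZ', mul_left_comm] at h
      exact (eq_div_iff hB).mpr (mul_left_cancel₀ hN h)
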